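/- For a finite simple graph $G$, the $(2:2)$ Connector-Breaker game on $E(G)$ is played as follows. Connector and Breaker move alternately; in each move, a player claims at most two edges of $G$ which have not been claimed before, and Connector must choose her edges in such a way that after each of her moves the graph formed by all edges she has claimed (with the endpoints of these edges as its vertices) is connected. Let $G_{n,p}$ denote the binomial random graph on $n$ labelled vertices in which each pair of vertices forms an edge independently with probability $p$. **Theorem.** Let $\varepsilon>0$ be a constant, and let $p=p(n)\in[0,1]$ satisfy $p\ge n^{-2/3+\varepsilon}$ for all sufficiently large $n$. Then, with probability tending to $1$ as $n\to\infty$, a random graph $G\sim G_{n,p}$ has the following property: in the $(2:2)$ Connector-Breaker game on $E(G)$, Connector has a strategy which guarantees that, after finitely many moves, the edges she has claimed contain all edges of a spanning tree of $G$. This holds regardless of which of the two players makes the first move. -/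

import Mathlib

namespace ConnectorBreaker

/-- The two players. -/
inductive Player where
  | connector
  | breaker

section Board

variable {V : Type*}

/-- The graph formed by the edges in `C` (its vertices being the endpoints of these edges) is
connected; the empty edge set is allowed. -/
def EdgesConnected (C : Finset (Sym2 V)) : Prop :=
  ∀ u ∈ (SimpleGraph.fromEdgeSet (C : Set (Sym2 V))).support,
    ∀ v ∈ (SimpleGraph.fromEdgeSet (C : Set (Sym2 V))).support,
      (SimpleGraph.fromEdgeSet (C : Set (Sym2 V))).Reachable u v

/-- The edge set `C` contains all edges of a spanning tree of `G`. -/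
def ContainsSpanningTree (G : SimpleGraph V) (C : Finset (Sym2 V)) : Prop :=
  ∃ T : SimpleGraph V, T ≤ G ∧ T.IsTree ∧ T.edgeSet ⊆ (C : Set (Sym2 V))

/-- A (deterministic) strategy for Connector: it gives the set of edges to claim next as a function
of the list of all moves made by Breaker so far (first move first). Connector's own earlier moves
are determined by that list and the strategy. -/
abbrev Strategy (V : Type*) := List (Finset (Sym2 V)) → Finset (Sym2 V)

variable [DecidableEq V]

/-- When Connector holds `C` and Breaker holds `B`, Breaker may claim the edges in `D`: these are
at most `b` free edges of the board `G`. -/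
def LegalBreakerMove (G : SimpleGraph V) (b : ℕ) (C B D : Finset (Sym2 V)) : Prop :=
  (D : Set (Sym2 V)) ⊆ G.edgeSet ∧ Disjoint D (C ∪ B) ∧ D.card ≤ b

/-- When Connector holds `C` and Breaker holds `B`, Connector may claim the edges in `A`: these are
at most `m` free edges of the board `G`, and Connector's graph is connected afterwards. -/
def LegalConnectorMove (G : SimpleGraph V) (m : ℕ) (C B A : Finset (Sym2 V)) : Prop :=
  (A : Set (Sym2 V)) ⊆ G.edgeSet ∧ Disjoint A (C ∪ B) ∧ A.card ≤ m ∧ EdgesConnected (C ∪ A)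

/-- The edges claimed in the first `i` moves of the sequence of moves `f`. -/
def claimed (f : ℕ → Finset (Sym2 V)) (i : ℕ) : Finset (Sym2 V) :=
  (Finset.range i).biUnion f

/-- The number of moves Breaker has made just before Connector's move number `i`
(moves are numbered from `0`, and the players alternate, starting with `first`). -/
def breakerMovesBefore (first : Player) (i : ℕ) : ℕ :=
  match first with
  | .connector => i
  | .breaker => i + 1

/-- The number of moves Connector has made just before Breaker's move number `i`. -/
def connectorMovesBefore (first : Player) (i : ℕ) : ℕ :=
  match first with
  | .connector => i + 1
  | .breaker => i

/-- Connector's move number `i` when she follows the strategy `S` and Breaker's moves are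
`β 0, β 1, …`. -/
def connectorMove (first : Player) (S : Strategy V) (β : ℕ → Finset (Sym2 V)) (i : ℕ) :
    Finset (Sym2 V) :=
  S ((List.range (breakerMovesBefore first i)).map β)

/-- `S` is a winning strategy for Connector in the `(m : b)` Connector-Breaker connectivity game on
the edge set of `G`, in which player `first` makes the first move: against every sequence of legal
Breaker moves, all moves prescribed by `S` are legal, and after finitely many moves the edges
claimed by Connector contain a spanning tree of `G`. (Claiming no edge is a legal move, so every
finite play is an initial part of an infinite sequence of moves as considered here.) -/
def IsWinningStrategy (G : SimpleGraph V) (m b : ℕ) (first : Player) (S : Strategy V) : Prop :=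
  ∀ β : ℕ → Finset (Sym2 V),
    (∀ i, LegalBreakerMove G b
      (claimed (connectorMove first S β) (connectorMovesBefore first i)) (claimed β i) (β i)) →
    (∀ i, LegalConnectorMove G m
      (claimed (connectorMove first S β) i) (claimed β (breakerMovesBefore first i))
      (connectorMove first S β i)) ∧
    ∃ i, ContainsSpanningTree G (claimed (connectorMove first S β) i)

/-- Connector has a strategy to claim a spanning tree of `G` in the `(m : b)` Connector-Breaker game
on the edge set of `G` with `first` moving first. -/
def ConnectorWins (G : SimpleGraph V) (m b : ℕ) (first : Player) : Prop :=
  ∃ S : Strategy V, IsWinningStrategy G m b first S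

end Board

end ConnectorBreaker

/-!
Connector's strategy is to head, again and again, for the untouched vertex `v` of largest Breaker
degree. If she can always reach the current target within a bounded number `J + 1` of moves, then
between two targets Breaker adds at most `K = 4 (J + 1)` to the sum of the degrees, and the usual
potential argument for the box game (`BoxInvariant.step`) shows that the Breaker degrees of
untouched vertices never exceed `K (1 + log n)`. Moreover Breaker then owns at most `K |T|` edges
when Connector has touched a set `T` of vertices. So it suffices to show that Connector can reach
any `v ∉ T` from any position with these two properties (`connectorWins_of_canEscape`).

To reach `v` she uses *escape trees*. If a touched vertex `u` has a free edge to the root `c` of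
such a tree, she claims `uc` and an edge `cd` of the tree. This opens three edge-disjoint continuations,
two at `d` and one at `c`, each a free edge to the root of an escape tree with a smaller parameter;
Breaker's two edges damage at most two of them (`WinsWithin.of_escapeTree`). The condition
`p ≥ n ^ (-2/3 + ε)` is what makes these trees abundant. There are about `n p` vertices with a free
edge to `v`, and two disjoint sets of `a ≤ 1 / p` vertices have about `n (p a) ^ 2` common
neighbours; this is much more than `a` as soon as `a` is much more than `1 / (n p ^ 2)`. Starting
with `a = n p`, this requires `n ^ 2 p ^ 3 → ∞`, and we have it with a power of `n` to spare. Each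
level of the trees needs two such steps, the first for the vertices `d` and the second for the
roots `c`. The tree edges are kept disjoint by splitting the vertices into boundedly many label
classes and using a fresh block of labels for every branch (`FreeRoot.node`).

If Connector could not reach `v`, every edge from `T` to a root would belong to Breaker. Then `T`
does not interfere with the growth of the sets of roots, and after boundedly many levels there are
slightly more than `1 / p` roots with each label (`Pseudorandom.exists_freeRoots`). One level later
nearly all untouched vertices are roots, and another level later all but very few of them are.
Finally the edges from `T` to roots outnumber the at most `K |T|` edges that Breaker has
(`Pseudorandom.canEscape`).

The properties of the graph that enter here (`Pseudorandom`) are deterministic. That the random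
graph has them follows from exponential moment estimates and a union bound over the sets of
vertices involved (`binomialRandom_not_pseudorandom_le`). The required numerical conditions are
expressed through a single quantity `s = n ^ η` with small `η > 0`, which exceeds all logarithms
and constants, while `s ^ 5 ≤ n p` and `s ^ 9 ≤ n ^ 2 p ^ 3` (`exists_parameters`).
-/

namespace ConnectorBreaker

/-! ### Positions and strategies -/

section Positions

variable {V : Type*} [DecidableEq V] {G : SimpleGraph V} {C B : Finset (Sym2 V)}

/-- `WinsWithin G k C B`: with Connector (holding `C`) to move against Breaker (holding `B`) in the
`(2 : 2)` game on `G`, she can force her edges to contain a spanning tree after at most `k` more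
moves of hers. -/
def WinsWithin (G : SimpleGraph V) : ℕ → Finset (Sym2 V) → Finset (Sym2 V) → Prop
  | 0, C, _ => ContainsSpanningTree G C
  | k + 1, C, B => ContainsSpanningTree G C ∨ ∃ A, LegalConnectorMove G 2 C B A ∧
      ∀ D, LegalBreakerMove G 2 (C ∪ A) B D → WinsWithin G k (C ∪ A) (B ∪ D)

lemma WinsWithin.of_containsSpanningTree (h : ContainsSpanningTree G C) :
    ∀ k, WinsWithin G k C B
  | 0 => h
  | _ + 1 => Or.inl h

lemma WinsWithin.succ : ∀ {k : ℕ} {C B : Finset (Sym2 V)}, WinsWithin G k C B →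
    WinsWithin G (k + 1) C B
  | 0, _, _, h => Or.inl h
  | _ + 1, _, _, Or.inl h => Or.inl h
  | _ + 1, _, _, Or.inr ⟨A, hA, h⟩ => Or.inr ⟨A, hA, fun D hD => (h D hD).succ⟩

lemma WinsWithin.mono {k l : ℕ} (hkl : k ≤ l) (h : WinsWithin G k C B) : WinsWithin G l C B := by
  induction hkl with
  | refl => exact h
  | step _ ih => exact ih.succ

/-- In every position there is one Connector move that is good for all values of `k` at once. -/
lemma exists_good_move (G : SimpleGraph V) (C B : Finset (Sym2 V)) : ∃ A,
    (EdgesConnected C → ∀ k, WinsWithin G k C B → LegalConnectorMove G 2 C B A) ∧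
    ∀ k, WinsWithin G k C B → ∀ D, LegalBreakerMove G 2 (C ∪ A) B D →
      WinsWithin G (k - 1) (C ∪ A) (B ∪ D) := by
  classical
  by_cases hw : ∃ k, WinsWithin G k C B
  · obtain hk := Nat.find_spec hw
    rcases hk0 : Nat.find hw with _ | k₀
    · rw [hk0] at hk
      refine ⟨∅, fun hC _ _ => ⟨by simp, by simp, by simp, by simpa using hC⟩, fun k _ D _ => ?_⟩
      rw [Finset.union_empty]
      exact .of_containsSpanningTree hk _
    · -- A winning move for the least possible `k` is good for all `k`.
      rw [hk0] at hk
      obtain h | ⟨A, hA, h⟩ := hk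
      · exact absurd (show WinsWithin G 0 C B from h) (Nat.find_min hw (by omega))
      · refine ⟨A, fun _ _ _ => hA, fun k hk D hD => (h D hD).mono ?_⟩
        have := Nat.find_min' hw hk
        omega
  · exact ⟨∅, fun _ k hk => absurd ⟨k, hk⟩ hw, fun k hk => absurd ⟨k, hk⟩ hw⟩

/-- One round (a Breaker move followed by Connector's reply) when Connector replies by `act`.
The state consists of Connector's edges before her latest move, Breaker's edges, and Connector's
latest move. -/
def playRound (act : Finset (Sym2 V) → Finset (Sym2 V) → Finset (Sym2 V))
    (s : Finset (Sym2 V) × Finset (Sym2 V) × Finset (Sym2 V)) (D : Finset (Sym2 V)) :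
    Finset (Sym2 V) × Finset (Sym2 V) × Finset (Sym2 V) :=
  (s.1 ∪ s.2.2, s.2.1 ∪ D, act (s.1 ∪ s.2.2) (s.2.1 ∪ D))

lemma claimed_succ (f : ℕ → Finset (Sym2 V)) (i : ℕ) :
    claimed f (i + 1) = claimed f i ∪ f i := by
  simp [claimed, Finset.range_add_one, Finset.biUnion_insert, Finset.union_comm]

/-- A positional win after every opening move of Breaker yields a winning strategy for Connector
as second player. -/
lemma connectorWins_breaker_of_winsWithin {k : ℕ}
    (h : ∀ D, LegalBreakerMove G 2 ∅ ∅ D → WinsWithin G k ∅ D) :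
    ConnectorWins G 2 2 .breaker := by
  choose act hact₁ hact₂ using exists_good_move G
  let S : Strategy V := fun l => (l.foldl (playRound act) (∅, ∅, ∅)).2.2
  refine ⟨S, fun β hβ => ?_⟩
  set c := connectorMove .breaker S β with hc
  let st : ℕ → Finset (Sym2 V) × Finset (Sym2 V) × Finset (Sym2 V) :=
    fun i => ((List.range i).map β).foldl (playRound act) (∅, ∅, ∅)
  have hst : ∀ i, st (i + 1) = playRound act (st i) (β i) := fun i => by
    simp [st, List.range_succ]
  have hci : ∀ i, c i = (st (i + 1)).2.2 := fun i => rfl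
  have hB : ∀ i, (st i).2.1 = claimed β i := by
    intro i
    induction i with
    | zero => simp [st, claimed]
    | succ i ih => rw [hst, claimed_succ, ← ih]; rfl
  have hC : ∀ i, (st (i + 1)).1 = claimed c i := by
    intro i
    induction i with
    | zero => rw [hst]; simp [st, claimed, playRound]
    | succ i ih => rw [hst, claimed_succ, ← ih, hci]; rfl
  have hcact : ∀ i, c i = act (claimed c i) (claimed β (i + 1)) := fun i => by
    rw [hci, ← hC, ← hB, hst (i), playRound]
  have hmain : ∀ i, WinsWithin G (k - i) (claimed c i) (claimed β (i + 1)) ∧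
      EdgesConnected (claimed c i) := by
    intro i
    induction i with
    | zero =>
      have := h (β 0) (by simpa [claimed, connectorMovesBefore] using hβ 0)
      refine ⟨by simpa [claimed] using this, ?_⟩
      intro u hu
      simp [claimed] at hu
    | succ i ih =>
      obtain ⟨hw, hE⟩ := ih
      have hleg := hact₁ _ _ hE _ hw
      rw [← hcact] at hleg
      rw [claimed_succ β, claimed_succ c]
      refine ⟨?_, hleg.2.2.2⟩
      have := hact₂ _ _ _ hw (β (i + 1)) (by
        rw [← hcact, ← claimed_succ c]; exact hβ (i + 1))
      rw [← hcact] at this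
      rwa [Nat.sub_sub] at this
  refine ⟨fun i => ?_, k, ?_⟩
  · have := hact₁ _ _ (hmain i).2 _ (hmain i).1
    rwa [← hcact] at this
  · have := (hmain k).1
    rwa [Nat.sub_self] at this

/-- Moving first is no disadvantage for Connector: she pretends that Breaker opened with an
empty move. -/
lemma ConnectorWins.of_breaker (h : ConnectorWins G 2 2 .breaker) (first : Player) :
    ConnectorWins G 2 2 first := by
  cases first with
  | breaker => exact h
  | connector =>
  obtain ⟨S, hS⟩ := h
  refine ⟨fun l => S (∅ :: l), fun β hβ => ?_⟩
  let β' : ℕ → Finset (Sym2 V) := fun i => Nat.casesOn i ∅ β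
  have hcl : ∀ i, claimed β' (i + 1) = claimed β i := by
    intro i
    induction i with
    | zero => simp [claimed, β']
    | succ i ih => rw [claimed_succ, ih, claimed_succ]
  have hmove : connectorMove .connector (fun l => S (∅ :: l)) β = connectorMove .breaker S β' := by
    funext i
    simp only [connectorMove, breakerMovesBefore, List.range_succ_eq_map, List.map_cons,
      List.map_map]
    rfl
  rw [hmove] at hβ ⊢
  have := hS β' (fun i => by
    cases i with
    | zero => exact ⟨by simp [β'], by simp [β'], by simp [β']⟩
    | succ i => rw [hcl]; exact hβ i)
  refine ⟨fun i => ?_, this.2⟩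
  have h1 := this.1 i
  simp only [breakerMovesBefore, hcl] at h1 ⊢
  exact h1

end Positions

/-! ### Escape trees -/

section Phase

variable {V : Type*} {G : SimpleGraph V} {C B : Finset (Sym2 V)} {T : Finset V}
  {w v : V}

/-- `Spans G w T C`: the edges in `C` belong to `G`, they join vertices of `T`, and they connect
all of `T` to the start vertex `w ∈ T`. Thus `T` consists of the vertices touched by Connector,
together with her start vertex. -/
structure Spans (G : SimpleGraph V) (w : V) (T : Finset V) (C : Finset (Sym2 V)) : Prop where
  start_mem : w ∈ T
  subset : (C : Set (Sym2 V)) ⊆ G.edgeSet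
  mem_of_mem : ∀ e ∈ C, ∀ a ∈ e, a ∈ T
  reachable : ∀ a ∈ T, (SimpleGraph.fromEdgeSet (C : Set (Sym2 V))).Reachable w a

lemma Spans.edgesConnected (h : Spans G w T C) : EdgesConnected C := by
  have key : ∀ u ∈ (SimpleGraph.fromEdgeSet (C : Set (Sym2 V))).support, u ∈ T := by
    rintro u ⟨x, hx⟩
    have hx := (SimpleGraph.fromEdgeSet_adj _).1 hx
    exact h.mem_of_mem _ hx.1 u (Sym2.mem_mk_left _ _)
  exact fun u hu x hx => (h.reachable u (key u hu)).symm.trans (h.reachable x (key x hx))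

lemma Spans.containsSpanningTree (h : Spans G w T C) (hT : ∀ a, a ∈ T) :
    ContainsSpanningTree G C := by
  have hconn : (SimpleGraph.fromEdgeSet (C : Set (Sym2 V))).Connected :=
    { preconnected := fun a b => (h.reachable a (hT a)).symm.trans (h.reachable b (hT b))
      nonempty := ⟨w⟩ }
  obtain ⟨F, hF, hFt⟩ := hconn.exists_isTree_le
  refine ⟨F, hF.trans ?_, hFt, ?_⟩
  · rw [SimpleGraph.fromEdgeSet_le]
    exact fun e he => h.subset he.1
  · refine (SimpleGraph.edgeSet_mono hF).trans ?_
    rw [SimpleGraph.edgeSet_fromEdgeSet]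
    exact Set.sdiff_subset

variable [DecidableEq V]

/-- Claiming an edge from `T` to `c` adds `c` to the set of touched vertices. -/
lemma Spans.insert_edge (h : Spans G w T C) {u c : V} (hu : u ∈ T) (huc : G.Adj u c) :
    Spans G w (insert c T) (insert s(u, c) C) where
  start_mem := Finset.mem_insert_of_mem h.start_mem
  subset := by
    rw [Finset.coe_insert]
    exact Set.insert_subset huc h.subset
  mem_of_mem := by
    intro e he a ha
    rcases Finset.mem_insert.1 he with rfl | he
    · rcases Sym2.mem_iff.1 ha with rfl | rfl
      · exact Finset.mem_insert_of_mem hu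
      · exact Finset.mem_insert_self _ _
    · exact Finset.mem_insert_of_mem (h.mem_of_mem e he a ha)
  reachable := by
    have hle : SimpleGraph.fromEdgeSet (C : Set (Sym2 V)) ≤
        SimpleGraph.fromEdgeSet ((insert s(u, c) C : Finset (Sym2 V)) : Set (Sym2 V)) :=
      SimpleGraph.fromEdgeSet_mono (by simp)
    intro a ha
    rcases Finset.mem_insert.1 ha with rfl | ha
    · refine ((h.reachable u hu).mono hle).trans (SimpleGraph.Adj.reachable ?_)
      rw [SimpleGraph.fromEdgeSet_adj]
      exact ⟨by simp, huc.ne⟩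
    · exact (h.reachable a ha).mono hle

/-- `EscapeTree G v j c E`: `E` is the edge set of a tree of depth parameter `j` with root `c`
along which Connector can walk to `v` from any touched neighbour of `c`. For `j = 0` the tree is
the edge `cv`. For `j + 1` the root `c` has two children `d` and `d'`, and `d` has two children `e`
and `e'`, where `e`, `e'` and `d'` are roots of trees of parameter `j`. The three branches hanging
off the path `cd` are edge-disjoint, so that two Breaker edges cannot damage all of them. -/
inductive EscapeTree (G : SimpleGraph V) (v : V) : ℕ → V → Finset (Sym2 V) → Prop
  | leaf {c : V} (hc : G.Adj c v) : EscapeTree G v 0 c {s(c, v)}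
  | node {j : ℕ} {c d d' e e' : V} {E₁ E₂ E₃ : Finset (Sym2 V)}
      (h₁ : EscapeTree G v j e E₁) (h₂ : EscapeTree G v j e' E₂) (h₃ : EscapeTree G v j d' E₃)
      (hcd : G.Adj c d) (hcd' : G.Adj c d') (hde : G.Adj d e) (hde' : G.Adj d e')
      (h₁₂ : Disjoint (insert s(d, e) E₁) (insert s(d, e') E₂))
      (h₁₃ : Disjoint (insert s(d, e) E₁) (insert s(c, d') E₃))
      (h₂₃ : Disjoint (insert s(d, e') E₂) (insert s(c, d') E₃)) :
      EscapeTree G v (j + 1) c (insert s(c, d)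
        (insert s(d, e) E₁ ∪ insert s(d, e') E₂ ∪ insert s(c, d') E₃))

/-- Connector claims a path of at most two free edges leaving `T`. -/
lemma WinsWithin.of_path {k : ℕ} {u c d : V} (h : Spans G w T C) (hu : u ∈ T)
    (huc : G.Adj u c) (hcd : G.Adj c d) (hB₁ : s(u, c) ∉ B) (hB₂ : s(c, d) ∉ B)
    (hwin : ∀ C' D, Spans G w (insert d (insert c T)) C' → LegalBreakerMove G 2 C' B D →
      WinsWithin G k C' (B ∪ D)) : WinsWithin G (k + 1) C B := by
  have hS := (h.insert_edge hu huc).insert_edge (Finset.mem_insert_self c T) hcd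
  have hC : C ∪ ({s(u, c), s(c, d)} \ C) = insert s(c, d) (insert s(u, c) C) := by
    rw [Finset.union_sdiff_self_eq_union]
    ext x
    simp only [Finset.mem_union, Finset.mem_insert, Finset.mem_singleton]
    tauto
  refine Or.inr ⟨{s(u, c), s(c, d)} \ C, ⟨?_, ?_, ?_, ?_⟩, fun D hD => ?_⟩
  · intro x hx
    have hx := (Finset.mem_sdiff.1 (Finset.mem_coe.1 hx)).1
    rcases Finset.mem_insert.1 hx with rfl | hx
    · exact huc
    · rw [Finset.mem_singleton.1 hx]
      exact hcd
  · rw [Finset.disjoint_union_right]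
    refine ⟨Finset.sdiff_disjoint, Finset.disjoint_left.2 fun x hx => ?_⟩
    have hx := (Finset.mem_sdiff.1 hx).1
    rcases Finset.mem_insert.1 hx with rfl | hx
    · exact hB₁
    · rwa [Finset.mem_singleton.1 hx]
  · exact (Finset.card_le_card Finset.sdiff_subset).trans Finset.card_le_two
  · rw [hC]
    exact hS.edgesConnected
  · rw [hC] at hD ⊢
    exact hwin _ D hS hD

lemma WinsWithin.of_edge {k : ℕ} {u c : V} (h : Spans G w T C) (hu : u ∈ T)
    (huc : G.Adj u c) (hB₁ : s(u, c) ∉ B)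
    (hwin : ∀ C' D, Spans G w (insert c T) C' → LegalBreakerMove G 2 C' B D →
      WinsWithin G k C' (B ∪ D)) : WinsWithin G (k + 1) C B := by
  refine .of_path h hu huc huc.symm hB₁ (by rwa [Sym2.eq_swap]) fun C' D hC' hD => ?_
  refine hwin C' D ?_ hD
  rwa [Finset.insert_eq_of_mem (Finset.mem_insert_of_mem hu)] at hC'

/-- From a touched vertex `u` with a free edge to the root of a free escape tree, Connector reaches
`v` within `j + 1` moves: she claims the edge to the root `c` and the edge `cd`, which creates
three edge-disjoint continuations, of which Breaker can destroy at most two. -/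
lemma WinsWithin.of_escapeTree {m j : ℕ} {c : V} {E : Finset (Sym2 V)}
    (hE : EscapeTree G v j c E) :
    ∀ {C B : Finset (Sym2 V)} {T : Finset V} {u : V}, Spans G w T C → u ∈ T → G.Adj u c →
      Disjoint (insert s(u, c) E) B →
      (∀ C' B' T', Spans G w T' C' → T ⊆ T' → v ∈ T' → B ⊆ B' → B'.card ≤ B.card + 2 * (j + 1) →
        WinsWithin G m C' B') → WinsWithin G (m + (j + 1)) C B := by
  induction hE with
  | @leaf c hc =>
    intro C B T u h hu huc hB hwin
    rw [Finset.disjoint_left] at hB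
    refine .of_path h hu huc hc (hB (by simp)) (hB (by simp)) fun C' D hC' hD => ?_
    refine hwin C' (B ∪ D) _ hC' (fun x hx => by simp [hx]) (by simp)
      Finset.subset_union_left ?_
    exact (Finset.card_union_le _ _).trans (by have := hD.2.2; omega)
  | @node j c d d' e e' E₁ E₂ E₃ h₁ h₂ h₃ hcd hcd' hde hde' h₁₂ h₁₃ h₂₃ ih₁ ih₂ ih₃ =>
    intro C B T u h hu huc hB hwin
    have hB' := hB
    rw [Finset.disjoint_left] at hB'
    refine .of_path h hu huc hcd (hB' (by simp)) (hB' (by simp)) fun C' D hC' hD => ?_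
    have hfree : ∀ {F : Finset (Sym2 V)}, F ⊆ insert s(d, e) E₁ ∪ insert s(d, e') E₂ ∪
        insert s(c, d') E₃ → Disjoint F D → Disjoint F (B ∪ D) := fun hF hFD => by
      refine Finset.disjoint_union_right.2 ⟨hB.mono_left (hF.trans fun x hx => ?_), hFD⟩
      exact Finset.mem_insert_of_mem (Finset.mem_insert_of_mem hx)
    have hD2 := hD.2.2
    have hwin' : ∀ C'' B'' T'', Spans G w T'' C'' → insert d (insert c T) ⊆ T'' → v ∈ T'' →
        B ∪ D ⊆ B'' → B''.card ≤ (B ∪ D).card + 2 * (j + 1) → WinsWithin G m C'' B'' := by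
      intro C'' B'' T'' hS hT hv hBB hcard
      refine hwin C'' B'' T'' hS (fun x hx => hT (by simp [hx])) hv
        (Finset.subset_union_left.trans hBB) (hcard.trans ?_)
      have := Finset.card_union_le B D
      omega
    -- Three pairwise disjoint sets cannot all meet the set `D` of at most two edges.
    have hpigeon : Disjoint (insert s(d, e) E₁) D ∨ Disjoint (insert s(d, e') E₂) D ∨
        Disjoint (insert s(c, d') E₃) D := by
      by_contra! hcon
      obtain ⟨c₁, c₂, c₃⟩ := hcon
      obtain ⟨x₁, hx₁, hy₁⟩ := Finset.not_disjoint_iff.1 c₁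
      obtain ⟨x₂, hx₂, hy₂⟩ := Finset.not_disjoint_iff.1 c₂
      obtain ⟨x₃, hx₃, hy₃⟩ := Finset.not_disjoint_iff.1 c₃
      have n₁₂ : x₁ ≠ x₂ := fun hh => Finset.disjoint_left.1 h₁₂ hx₁ (hh ▸ hx₂)
      have n₁₃ : x₁ ≠ x₃ := fun hh => Finset.disjoint_left.1 h₁₃ hx₁ (hh ▸ hx₃)
      have n₂₃ : x₂ ≠ x₃ := fun hh => Finset.disjoint_left.1 h₂₃ hx₂ (hh ▸ hx₃)
      have h3 : ({x₁, x₂, x₃} : Finset (Sym2 V)).card = 3 := by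
        rw [Finset.card_eq_three]
        exact ⟨x₁, x₂, x₃, n₁₂, n₁₃, n₂₃, rfl⟩
      have hle : ({x₁, x₂, x₃} : Finset (Sym2 V)) ⊆ D := by
        simp [Finset.insert_subset_iff, hy₁, hy₂, hy₃]
      have := Finset.card_le_card hle
      omega
    rcases hpigeon with hp | hp | hp
    · exact ih₁ hC' (by simp) hde (hfree (fun x hx => by simp only [Finset.mem_union]; tauto) hp)
        hwin'
    · exact ih₂ hC' (by simp) hde' (hfree (fun x hx => by simp only [Finset.mem_union]; tauto) hp)
        hwin'
    · exact ih₃ hC' (by simp) hcd' (hfree (fun x hx => by simp only [Finset.mem_union]; tauto) hp)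
        hwin'

end Phase

/-! ### The box game -/

section BoxGame

variable {V : Type*} [DecidableEq V]

/-- The number of edges in `B` at the vertex `u`. -/
def edgeDegree (B : Finset (Sym2 V)) (u : V) : ℕ := (B.filter (u ∈ ·)).card

lemma sum_edgeDegree_le (B : Finset (Sym2 V)) (S : Finset V) :
    ∑ u ∈ S, edgeDegree B u ≤ 2 * B.card := by
  have h : ∀ e ∈ B, (S.filter (· ∈ e)).card ≤ 2 := by
    intro e _
    induction e with
    | _ a b =>
    refine (Finset.card_le_card fun x hx => ?_).trans (Finset.card_le_two (a := a) (b := b))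
    simpa using (Finset.mem_filter.1 hx).2
  calc ∑ u ∈ S, edgeDegree B u = ∑ e ∈ B, (S.filter (· ∈ e)).card := by
        simp only [edgeDegree, Finset.card_filter]
        exact Finset.sum_comm
    _ ≤ ∑ _e ∈ B, 2 := Finset.sum_le_sum h
    _ = 2 * B.card := by simp [mul_comm]

lemma edgeDegree_union_le (B D : Finset (Sym2 V)) (u : V) :
    edgeDegree (B ∪ D) u ≤ edgeDegree B u + edgeDegree D u := by
  rw [edgeDegree, Finset.filter_union]
  exact Finset.card_union_le _ _

variable [Fintype V] {G : SimpleGraph V}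

/-- The largest number of Breaker edges at `s` untouched vertices that the box game strategy
allows on average, when there are `n` vertices and Breaker adds at most `K` to the total degree
between two treatments: `K (1/s + 1/(s+1) + ⋯ + 1/n)`. -/
noncomputable def boxBound (K n s : ℕ) : ℝ := K * ∑ i ∈ Finset.Icc s n, (1 / i : ℝ)

lemma boxBound_succ {K n s : ℕ} (hs : s ≤ n) :
    boxBound K n s = boxBound K n (s + 1) + K / s := by
  rw [boxBound, boxBound, ← Finset.insert_Icc_add_one_left_eq_Icc hs, Finset.sum_insert (by simp)]
  ring

lemma boxBound_le {K n : ℕ} : boxBound K n 1 ≤ K * (1 + Real.log n) := by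
  rw [boxBound]
  gcongr
  have := harmonic_le_one_add_log n
  rw [harmonic_eq_sum_Icc] at this
  push_cast at this
  simpa using this

lemma le_mul_boxBound {K n s : ℕ} (hs : 0 < s) (hsn : s ≤ n) : (K : ℝ) ≤ s * boxBound K n s := by
  have h1 : (1 / s : ℝ) ≤ ∑ i ∈ Finset.Icc s n, (1 / i : ℝ) :=
    Finset.single_le_sum (f := fun i : ℕ => (1 / i : ℝ)) (fun i _ => by positivity)
      (Finset.mem_Icc.2 ⟨le_rfl, hsn⟩)
  have hs' : (0 : ℝ) < s := by exact_mod_cast hs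
  calc (K : ℝ) = s * (K * (1 / s)) := by field_simp
    _ ≤ s * boxBound K n s := by rw [boxBound]; gcongr

/-- The box game invariant: any `s` untouched vertices have average Breaker degree at most
`boxBound K n s`, where `n` is the number of vertices. -/
def BoxInvariant (K : ℕ) (T : Finset V) (B : Finset (Sym2 V)) : Prop :=
  ∀ S : Finset V, Disjoint S T → S.Nonempty →
    ((∑ u ∈ S, edgeDegree B u : ℕ) : ℝ) ≤ S.card * boxBound K (Fintype.card V) S.card

lemma BoxInvariant.edgeDegree_le {K : ℕ} {T : Finset V} {B : Finset (Sym2 V)}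
    (h : BoxInvariant K T B) {u : V} (hu : u ∉ T) :
    (edgeDegree B u : ℝ) ≤ K * (1 + Real.log (Fintype.card V)) := by
  have := h {u} (by simpa) (by simp)
  simp only [Finset.sum_singleton, Finset.card_singleton, Nat.cast_one, one_mul] at this
  exact this.trans boxBound_le

/-- The invariant survives if the untouched vertex `v` of largest Breaker degree is touched while
Breaker adds at most `K` to the total degree: before the step, the average over `S` was at most
the average over `S ∪ {v}`. -/
lemma BoxInvariant.step {K : ℕ} {T T' : Finset V} {B B' : Finset (Sym2 V)} {v : V}
    (h : BoxInvariant K T B) (hv : v ∉ T) (hmax : ∀ u ∉ T, edgeDegree B u ≤ edgeDegree B v)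
    (hT : T ⊆ T') (hv' : v ∈ T') (hB : B ⊆ B') (hcard : 2 * B'.card ≤ 2 * B.card + K) :
    BoxInvariant K T' B' := by
  intro S hS hne
  have hvS : v ∉ S := fun hvS => Finset.disjoint_left.1 hS hvS hv'
  have hST : Disjoint S T := hS.mono_right hT
  have hcards : (insert v S).card = S.card + 1 := Finset.card_insert_of_notMem hvS
  have hle : S.card + 1 ≤ Fintype.card V := hcards ▸ Finset.card_le_univ _
  have h1 := h (insert v S) (by
    rw [Finset.disjoint_insert_left]; exact ⟨hv, hST⟩) (by simp)
  rw [hcards, Finset.sum_insert hvS] at h1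
  have h2 : ∑ u ∈ S, edgeDegree B u ≤ S.card * edgeDegree B v := by
    rw [← smul_eq_mul]
    exact Finset.sum_le_card_nsmul _ _ _ fun u hu => hmax u (Finset.disjoint_left.1 hST hu)
  have h3 : ∑ u ∈ S, edgeDegree B' u ≤ ∑ u ∈ S, edgeDegree B u + K := by
    have e1 : B' = B ∪ B' \ B := by rw [Finset.union_sdiff_of_subset hB]
    have e2 : (B' \ B).card + B.card = B'.card := Finset.card_sdiff_add_card_eq_card hB
    have e3 := sum_edgeDegree_le (B' \ B) S
    calc ∑ u ∈ S, edgeDegree B' u ≤ ∑ u ∈ S, (edgeDegree B u + edgeDegree (B' \ B) u) := by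
          refine Finset.sum_le_sum fun u _ => ?_
          conv_lhs => rw [e1]
          exact edgeDegree_union_le _ _ _
      _ ≤ ∑ u ∈ S, edgeDegree B u + K := by
          rw [Finset.sum_add_distrib]
          omega
  have hs : (0 : ℝ) < S.card := by exact_mod_cast hne.card_pos
  rw [boxBound_succ (by omega : S.card ≤ Fintype.card V)]
  have h2' : ((∑ u ∈ S, edgeDegree B u : ℕ) : ℝ) ≤ S.card * edgeDegree B v := by exact_mod_cast h2
  have h3' : ((∑ u ∈ S, edgeDegree B' u : ℕ) : ℝ) ≤ ((∑ u ∈ S, edgeDegree B u : ℕ) : ℝ) + K := by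
    exact_mod_cast h3
  set g := boxBound K (Fintype.card V) (S.card + 1)
  set σ : ℝ := ((∑ u ∈ S, edgeDegree B u : ℕ) : ℝ)
  have h1' : (edgeDegree B v : ℝ) + σ ≤ (S.card + 1) * g := by
    have := h1
    push_cast at this
    simpa [σ] using this
  -- `σ / |S|` is at most the degree of `v`, hence at most the average over `S ∪ {v}`.
  have hσ : σ ≤ S.card * g := by
    have : (S.card + 1) * σ ≤ (S.card + 1) * (S.card * g) := by nlinarith
    exact le_of_mul_le_mul_left this (by positivity)
  calc _ ≤ σ + K := h3'
    _ ≤ S.card * g + K := by linarith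
    _ = S.card * (g + K / S.card) := by field_simp

/-- A set of at most two edges satisfies the box game invariant. -/
lemma BoxInvariant.init {K : ℕ} (hK : 4 ≤ K) {T : Finset V} {B : Finset (Sym2 V)}
    (hB : B.card ≤ 2) : BoxInvariant K T B := by
  intro S _ hne
  refine le_trans ?_ (le_mul_boxBound hne.card_pos (Finset.card_le_univ _))
  have := sum_edgeDegree_le B S
  exact_mod_cast (by omega : ∑ u ∈ S, edgeDegree B u ≤ K)

/-- `CanEscape G J T B v`: some touched vertex has a free edge to `v` or a free edge to the root of
a free escape tree for `v` with parameter at most `J`. -/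
def CanEscape (G : SimpleGraph V) (J : ℕ) (T : Finset V) (B : Finset (Sym2 V)) (v : V) : Prop :=
  (∃ u ∈ T, G.Adj u v ∧ s(u, v) ∉ B) ∨
    ∃ j ≤ J, ∃ u ∈ T, ∃ c E, EscapeTree G v j c E ∧ G.Adj u c ∧ Disjoint (insert s(u, c) E) B

/-- If Connector can escape to every untouched vertex as long as the Breaker degrees of untouched
vertices and the number of Breaker edges are bounded suitably, then she wins: she always heads for
the untouched vertex of largest Breaker degree. -/
lemma winsWithin_of_canEscape {J K : ℕ} (hK : K = 4 * (J + 1)) {w : V}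
    (hesc : ∀ (T : Finset V) (B : Finset (Sym2 V)) (v : V), w ∈ T → v ∉ T →
      (∀ u ∉ T, (edgeDegree B u : ℝ) ≤ K * (1 + Real.log (Fintype.card V))) →
      B.card ≤ K * T.card → CanEscape G J T B v) :
    ∀ (N : ℕ) {T : Finset V} {C B : Finset (Sym2 V)}, Tᶜ.card ≤ N → Spans G w T C →
      BoxInvariant K T B → B.card ≤ K * T.card → WinsWithin G (N * (J + 1)) C B := by
  intro N
  induction N with
  | zero =>
    intro T C B hN hS _ _
    refine .of_containsSpanningTree (hS.containsSpanningTree fun a => ?_) _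
    have : Tᶜ = ∅ := Finset.card_eq_zero.1 (Nat.le_zero.1 hN)
    simp [(Finset.compl_eq_empty_iff _).1 this]
  | succ N ih =>
    intro T C B hN hS hbox hB
    rcases Tᶜ.eq_empty_or_nonempty with hT | hT
    · refine .of_containsSpanningTree (hS.containsSpanningTree fun a => ?_) _
      simp [(Finset.compl_eq_empty_iff _).1 hT]
    obtain ⟨v, hv, hmax⟩ := Finset.exists_max_image Tᶜ (edgeDegree B) hT
    simp only [Finset.mem_compl] at hv hmax
    have hnext : ∀ C' B' T', Spans G w T' C' → T ⊆ T' → v ∈ T' → B ⊆ B' →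
        B'.card ≤ B.card + 2 * (J + 1) → WinsWithin G (N * (J + 1)) C' B' := by
      intro C' B' T' hS' hTT hvT hBB hcard
      have hlt : T.card + 1 ≤ T'.card :=
        Finset.card_lt_card (Finset.ssubset_iff_subset_ne.2 ⟨hTT, fun hh => hv (hh ▸ hvT)⟩)
      refine ih ?_ hS' (hbox.step hv hmax hTT hvT hBB (by omega)) ?_
      · rw [Finset.card_compl] at hN ⊢
        omega
      · calc B'.card ≤ K * T.card + K := by omega
          _ = K * (T.card + 1) := by ring
          _ ≤ K * T'.card := Nat.mul_le_mul_left _ hlt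
    rw [Nat.succ_mul]
    rcases hesc T B v hS.start_mem hv (fun u hu => hbox.edgeDegree_le hu) hB with
      ⟨u, hu, huv, huB⟩ | ⟨j, hj, u, hu, c, E, hE, huc, hdisj⟩
    · refine (WinsWithin.of_edge (k := N * (J + 1)) hS hu huv huB fun C' D hC' hD => ?_).mono
        (by omega)
      refine hnext C' (B ∪ D) _ hC' (Finset.subset_insert _ _) (Finset.mem_insert_self _ _)
        Finset.subset_union_left ((Finset.card_union_le _ _).trans ?_)
      have := hD.2.2
      omega
    · refine (WinsWithin.of_escapeTree (m := N * (J + 1)) hE hS hu huc hdisj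
        fun C' B' T' h1 h2 h3 h4 h5 => hnext C' B' T' h1 h2 h3 h4 (by omega)).mono (by omega)

/-- The hypothesis of `winsWithin_of_canEscape` for one start vertex lets Connector win as either
player. -/
lemma connectorWins_of_canEscape {J K : ℕ} (hK : K = 4 * (J + 1)) (w : V)
    (hesc : ∀ (T : Finset V) (B : Finset (Sym2 V)) (v : V), w ∈ T → v ∉ T →
      (∀ u ∉ T, (edgeDegree B u : ℝ) ≤ K * (1 + Real.log (Fintype.card V))) →
      B.card ≤ K * T.card → CanEscape G J T B v) (first : Player) :
    ConnectorWins G 2 2 first := by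
  refine ConnectorWins.of_breaker (connectorWins_breaker_of_winsWithin
    (k := Fintype.card V * (J + 1)) fun D hD => ?_) first
  refine winsWithin_of_canEscape hK hesc _ (T := {w}) (Finset.card_le_univ _)
    ⟨by simp, by simp, by simp, by simp⟩ (.init (by omega) hD.2.2) ?_
  have := hD.2.2
  rw [Finset.card_singleton]
  omega

end BoxGame

/-! ### Existence of escape trees in pseudorandom graphs -/

section Existence

open scoped Classical

variable {V : Type*} [DecidableEq V]

/-- The number of labels used by an escape tree with parameter `j` (`v` not counted). -/
def numLabels : ℕ → ℕ
  | 0 => 1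
  | j + 1 => 2 + 3 * numLabels j

lemma numLabels_pos : ∀ j, 0 < numLabels j
  | 0 => Nat.one_pos
  | _ + 1 => by rw [numLabels]; omega

section Pseudorandom

variable [Fintype V]

/-- The pseudorandomness of `G` that the existence of escape trees relies on. The vertices carry
labels `cls`, of which the labels below `q` are used. -/
structure Pseudorandom (G : SimpleGraph V) (cls : V → ℕ) (q d d₂ a₀ M R D : ℕ) : Prop where
  /-- Every vertex has at least `d` neighbours with each label. -/
  degree : ∀ v, ∀ o < q, d ≤ (Finset.univ.filter fun x => G.Adj v x ∧ cls x = o).card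
  /-- Many vertices with a given label have neighbours in both of two medium-sized sets. -/
  common : ∀ o < q, ∀ A A' : Finset V, Disjoint A A' → (∀ x ∈ A, cls x ≠ o) →
    (∀ x ∈ A', cls x ≠ o) → A'.card = A.card → a₀ ≤ A.card → A.card ≤ M →
    4 * D * A.card ≤ (Finset.univ.filter fun x => cls x = o ∧ (∃ y ∈ A, G.Adj x y) ∧
      ∃ y ∈ A', G.Adj x y).card
  /-- There are many edges between any two large sets. -/
  cross : ∀ A S : Finset V, Disjoint S A → A.card = M → S.card = M →
    D * M < ((S ×ˢ A).filter fun z => G.Adj z.1 z.2).card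
  /-- Few vertices have many neighbours in a given set of moderate size. -/
  concentrated : ∀ U : Finset V, U.card ≤ 3 * M →
    (Finset.univ.filter fun x => d₂ ≤ (U.filter fun y => G.Adj x y).card).card < R
  /-- The label classes are large. -/
  size : ∀ o < q, 4 * M + 1 ≤ (Finset.univ.filter fun x => cls x = o).card

end Pseudorandom

variable {G : SimpleGraph V} {cls : V → ℕ} {B : Finset (Sym2 V)} {T : Finset V} {v : V}

/-- `FreeRoot G cls B T v j o c`: the untouched vertex `c` with label `o` is the root of an escape
tree for `v` that avoids `B` and whose vertices other than `v` have labels between `o` and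
`o + numLabels j`. -/
def FreeRoot (G : SimpleGraph V) (cls : V → ℕ) (B : Finset (Sym2 V)) (T : Finset V) (v : V)
    (j o : ℕ) (c : V) : Prop :=
  c ∉ T ∧ c ≠ v ∧ cls c = o ∧ ∃ E, EscapeTree G v j c E ∧ Disjoint E B ∧
    ∀ f ∈ E, (∃ a ∈ f, a ≠ v ∧ o ≤ cls a ∧ cls a < o + numLabels j) ∧
      ∀ a ∈ f, a = v ∨ (o ≤ cls a ∧ cls a < o + numLabels j)

/-- An edge of `G` that Breaker does not own. -/
def FreeAdj (G : SimpleGraph V) (B : Finset (Sym2 V)) (x y : V) : Prop := G.Adj x y ∧ s(x, y) ∉ B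

lemma FreeRoot.leaf {c : V} (hcT : c ∉ T) (hc : FreeAdj G B c v) :
    FreeRoot G cls B T v 0 (cls c) c := by
  refine ⟨hcT, hc.1.ne, rfl, _, .leaf hc.1, Finset.disjoint_singleton_left.2 hc.2, ?_⟩
  intro f hf
  rw [Finset.mem_singleton.1 hf]
  refine ⟨⟨c, by simp, hc.1.ne, le_rfl, by simp [numLabels]⟩, fun a ha => ?_⟩
  rcases Sym2.mem_iff.1 ha with rfl | rfl
  · exact Or.inr ⟨le_rfl, by simp [numLabels]⟩
  · exact Or.inl rfl

/-- Free trees on consecutive blocks of labels combine to a larger free tree. -/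
lemma FreeRoot.node {j o : ℕ} {c d d' e e' : V}
    (h₁ : FreeRoot G cls B T v j (o + 2) e)
    (h₂ : FreeRoot G cls B T v j (o + 2 + numLabels j) e')
    (h₃ : FreeRoot G cls B T v j (o + 2 + 2 * numLabels j) d')
    (hcT : c ∉ T) (hcv : c ≠ v) (hc : cls c = o) (hdv : d ≠ v) (hd : cls d = o + 1)
    (hcd : FreeAdj G B c d) (hcd' : FreeAdj G B c d')
    (hde : FreeAdj G B d e) (hde' : FreeAdj G B d e') :
    FreeRoot G cls B T v (j + 1) o c := by
  obtain ⟨-, hev, he, E₁, ht₁, hB₁, hl₁⟩ := h₁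
  obtain ⟨-, hev', he', E₂, ht₂, hB₂, hl₂⟩ := h₂
  obtain ⟨-, hdv', hd', E₃, ht₃, hB₃, hl₃⟩ := h₃
  have hN := numLabels_pos j
  set N := numLabels j with hNdef
  -- The branches are described by their labels, which makes them edge-disjoint.
  have p₁ : ∀ f ∈ insert s(d, e) E₁,
      (∃ a ∈ f, a ≠ v ∧ o + 2 ≤ cls a ∧ cls a < o + 2 + N) ∧
      ∀ a ∈ f, a = v ∨ cls a < o + 2 + N := by
    intro f hf
    rcases Finset.mem_insert.1 hf with rfl | hf
    · refine ⟨⟨e, by simp, hev, by omega, by omega⟩, fun a ha => Or.inr ?_⟩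
      rcases Sym2.mem_iff.1 ha with rfl | rfl <;> omega
    · obtain ⟨⟨a, ha, h⟩, hall⟩ := hl₁ f hf
      exact ⟨⟨a, ha, h⟩, fun b hb => (hall b hb).imp_right fun h => h.2⟩
  have p₂ : ∀ f ∈ insert s(d, e') E₂,
      (∃ a ∈ f, a ≠ v ∧ o + 2 + N ≤ cls a ∧ cls a < o + 2 + 2 * N) ∧
      ∀ a ∈ f, a = v ∨ cls a = o + 1 ∨ (o + 2 + N ≤ cls a ∧ cls a < o + 2 + 2 * N) := by
    intro f hf
    rcases Finset.mem_insert.1 hf with rfl | hf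
    · refine ⟨⟨e', by simp, hev', by omega, by omega⟩, fun a ha => Or.inr ?_⟩
      rcases Sym2.mem_iff.1 ha with rfl | rfl <;> omega
    · obtain ⟨⟨a, ha, h⟩, hall⟩ := hl₂ f hf
      exact ⟨⟨a, ha, h.1, h.2.1, by omega⟩, fun b hb => (hall b hb).imp_right fun h => by omega⟩
  have p₃ : ∀ f ∈ insert s(c, d') E₃,
      (∃ a ∈ f, a ≠ v ∧ o + 2 + 2 * N ≤ cls a ∧ cls a < o + 2 + 3 * N) ∧
      ∀ a ∈ f, a = v ∨ cls a = o ∨ o + 2 + 2 * N ≤ cls a := by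
    intro f hf
    rcases Finset.mem_insert.1 hf with rfl | hf
    · refine ⟨⟨d', by simp, hdv', by omega, by omega⟩, fun a ha => Or.inr ?_⟩
      rcases Sym2.mem_iff.1 ha with rfl | rfl <;> omega
    · obtain ⟨⟨a, ha, h⟩, hall⟩ := hl₃ f hf
      exact ⟨⟨a, ha, h.1, h.2.1, by omega⟩, fun b hb => (hall b hb).imp_right fun h => by omega⟩
  refine ⟨hcT, hcv, hc, _, .node ht₁ ht₂ ht₃ hcd.1 hcd'.1 hde.1 hde'.1 ?_ ?_ ?_, ?_, ?_⟩
  · refine Finset.disjoint_left.2 fun f hf hf' => ?_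
    obtain ⟨a, ha, hav, h1, h2⟩ := (p₁ f hf).1
    have := (p₂ f hf').2 a ha
    simp only [hav, false_or] at this
    omega
  · refine Finset.disjoint_left.2 fun f hf hf' => ?_
    obtain ⟨a, ha, hav, h1, h2⟩ := (p₁ f hf).1
    have := (p₃ f hf').2 a ha
    simp only [hav, false_or] at this
    omega
  · refine Finset.disjoint_left.2 fun f hf hf' => ?_
    obtain ⟨a, ha, hav, h1, h2⟩ := (p₂ f hf).1
    have := (p₃ f hf').2 a ha
    simp only [hav, false_or] at this
    omega
  · simp only [Finset.disjoint_insert_left, Finset.disjoint_union_left]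
    exact ⟨hcd.2, ⟨⟨hde.2, hB₁⟩, hde'.2, hB₂⟩, hcd'.2, hB₃⟩
  · have hNs : numLabels (j + 1) = 2 + 3 * N := rfl
    intro f hf
    rw [hNs]
    rcases Finset.mem_insert.1 hf with rfl | hf
    · refine ⟨⟨c, by simp, hcv, by omega, by omega⟩, fun a ha => Or.inr ?_⟩
      rcases Sym2.mem_iff.1 ha with rfl | rfl <;> omega
    · simp only [Finset.mem_union] at hf
      rcases hf with (hf | hf) | hf
      · rcases Finset.mem_insert.1 hf with rfl | hf
        · refine ⟨⟨e, by simp, hev, by omega, by omega⟩, fun a ha => Or.inr ?_⟩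
          rcases Sym2.mem_iff.1 ha with rfl | rfl <;> omega
        · obtain ⟨⟨a, ha, h⟩, hall⟩ := hl₁ f hf
          exact ⟨⟨a, ha, h.1, by omega⟩, fun b hb => (hall b hb).imp_right fun h => by omega⟩
      · obtain ⟨⟨a, ha, h⟩, hall⟩ := p₂ f hf
        exact ⟨⟨a, ha, h.1, by omega⟩, fun b hb => (hall b hb).imp_right fun h => by omega⟩
      · rcases Finset.mem_insert.1 hf with rfl | hf
        · refine ⟨⟨d', by simp, hdv', by omega, by omega⟩, fun a ha => Or.inr ?_⟩
          rcases Sym2.mem_iff.1 ha with rfl | rfl <;> omega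
        · obtain ⟨⟨a, ha, h⟩, hall⟩ := hl₃ f hf
          exact ⟨⟨a, ha, h.1, by omega⟩, fun b hb => (hall b hb).imp_right fun h => by omega⟩

lemma mem_of_not_canEscape {J j o : ℕ} (hesc : ¬ CanEscape G J T B v) (hj : j ≤ J) {u c : V}
    (hu : u ∈ T) (hc : FreeRoot G cls B T v j o c) (huc : G.Adj u c) : s(u, c) ∈ B := by
  by_contra h
  obtain ⟨-, -, -, E, hE, hEB, -⟩ := hc
  exact hesc (Or.inr ⟨j, hj, u, hu, c, E, hE, huc, Finset.disjoint_insert_left.2 ⟨h, hEB⟩⟩)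

lemma mem_of_not_canEscape_of_adj {J : ℕ} (hesc : ¬ CanEscape G J T B v) {u : V}
    (hu : u ∈ T) (huv : G.Adj u v) : s(u, v) ∈ B := by
  by_contra h
  exact hesc (Or.inl ⟨u, hu, huv, h⟩)

lemma card_filter_mem_le_edgeDegree (B : Finset (Sym2 V)) (y : V) (S : Finset V) :
    (S.filter fun x => s(x, y) ∈ B).card ≤ edgeDegree B y := by
  refine Finset.card_le_card_of_injOn (fun x => s(x, y)) ?_ ?_
  · intro x hx
    have := (Finset.mem_filter.1 (Finset.mem_coe.1 hx)).2
    simp [this]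
  · intro x _ x' _ h
    exact Sym2.congr_left.1 h

variable [Fintype V]

/-- If no edge of `G` between the large disjoint sets `S` and `A` were free, then Breaker would own
many edges at vertices of `A`. -/
lemma Pseudorandom.exists_freeAdj {q d d₂ a₀ M R D : ℕ} (hG : Pseudorandom G cls q d d₂ a₀ M R D)
    (hdeg : ∀ u ∉ T, edgeDegree B u ≤ D) {A S : Finset V} (hA : A.card = M) (hS : S.card = M)
    (hAS : Disjoint S A) (hAT : ∀ x ∈ A, x ∉ T) : ∃ x ∈ S, ∃ y ∈ A, FreeAdj G B x y := by
  by_contra! hcon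
  have h1 : ((S ×ˢ A).filter fun z => G.Adj z.1 z.2).card ≤ A.card * D := by
    calc ((S ×ˢ A).filter fun z => G.Adj z.1 z.2).card
        ≤ ((A.biUnion fun y => (S.filter fun x => s(x, y) ∈ B).image fun x => (x, y))).card := by
          refine Finset.card_le_card ?_
          rintro ⟨x, y⟩ hz
          simp only [Finset.mem_filter, Finset.mem_product] at hz
          simp only [Finset.mem_biUnion, Finset.mem_image, Finset.mem_filter]
          refine ⟨y, hz.1.2, x, ⟨hz.1.1, ?_⟩, rfl⟩
          by_contra hB
          exact hcon x hz.1.1 y hz.1.2 ⟨hz.2, hB⟩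
      _ ≤ A.card * D := by
          refine Finset.card_biUnion_le_card_mul _ _ _ fun y hy => Finset.card_image_le.trans ?_
          exact (card_filter_mem_le_edgeDegree B y S).trans (hdeg y (hAT y hy))
  have h2 := hG.cross A S hAS hA hS
  rw [hA, mul_comm] at h1
  omega

/-- Two sets `A` and `A'` of untouched vertices have many common free neighbours outside `T`,
provided that no edge from `T` to `A'` is free. -/
lemma Pseudorandom.exists_common {q d d₂ a₀ M R D : ℕ} (hG : Pseudorandom G cls q d d₂ a₀ M R D)
    (hD : 1 ≤ D) (ha₀ : 1 ≤ a₀)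
    (hdeg : ∀ u ∉ T, edgeDegree B u ≤ D) (v : V) {o : ℕ} (ho : o < q) {A A' : Finset V}
    (hAA : Disjoint A A') (hAo : ∀ x ∈ A, cls x ≠ o) (hAo' : ∀ x ∈ A', cls x ≠ o)
    (hcard : A'.card = A.card) (h₁ : a₀ ≤ A.card) (h₂ : A.card ≤ M)
    (hAT : ∀ x ∈ A, x ∉ T) (hAT' : ∀ x ∈ A', x ∉ T)
    (hfree : ∀ x ∈ T, ∀ y ∈ A', G.Adj x y → s(x, y) ∈ B) :
    D * A.card ≤ (Finset.univ.filter fun x => cls x = o ∧ x ∉ T ∧ x ≠ v ∧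
      (∃ y ∈ A, FreeAdj G B x y) ∧ ∃ y ∈ A', FreeAdj G B x y).card := by
  have hc := hG.common o ho A A' hAA hAo hAo' hcard h₁ h₂
  set good := Finset.univ.filter fun x => cls x = o ∧ x ∉ T ∧ x ≠ v ∧
      (∃ y ∈ A, FreeAdj G B x y) ∧ ∃ y ∈ A', FreeAdj G B x y with hgood
  set nb : Finset V → Finset V := fun A =>
    A.biUnion fun y => Finset.univ.filter fun x => s(x, y) ∈ B with hnb
  have hnbc : ∀ A : Finset V, (∀ x ∈ A, x ∉ T) → (nb A).card ≤ A.card * D := fun A hA =>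
    Finset.card_biUnion_le_card_mul _ _ _ fun y hy =>
      (card_filter_mem_le_edgeDegree B y _).trans (hdeg y (hA y hy))
  have hsub : (Finset.univ.filter fun x => cls x = o ∧ (∃ y ∈ A, G.Adj x y) ∧
      ∃ y ∈ A', G.Adj x y) ⊆ good ∪ ({v} ∪ (nb A ∪ nb A')) := by
    intro x hx
    obtain ⟨-, hxo, ⟨y, hy, hxy⟩, ⟨y', hy', hxy'⟩⟩ := Finset.mem_filter.1 hx
    by_cases hB : s(x, y) ∈ B
    · simp only [hnb, Finset.mem_union, Finset.mem_biUnion, Finset.mem_filter,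
        Finset.mem_univ, true_and]
      exact Or.inr (Or.inr (Or.inl ⟨y, hy, hB⟩))
    by_cases hB' : s(x, y') ∈ B
    · simp only [hnb, Finset.mem_union, Finset.mem_biUnion, Finset.mem_filter,
        Finset.mem_univ, true_and]
      exact Or.inr (Or.inr (Or.inr ⟨y', hy', hB'⟩))
    by_cases hxv : x = v
    · simp [hxv]
    refine Finset.mem_union_left _ (Finset.mem_filter.2 ⟨Finset.mem_univ _, hxo, fun hxT => ?_, hxv,
      ⟨y, hy, hxy, hB⟩, ⟨y', hy', hxy', hB'⟩⟩)
    exact hB' (hfree x hxT y' hy' hxy')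
  have h3 := Finset.card_le_card hsub
  have h4 := Finset.card_union_le good ({v} ∪ (nb A ∪ nb A'))
  have h5 := Finset.card_union_le {v} (nb A ∪ nb A')
  have h6 := Finset.card_union_le (nb A) (nb A')
  have h7 := hnbc A hAT
  have h8 := hnbc A' hAT'
  rw [Finset.card_singleton] at h5
  rw [hcard] at h8
  have h9 : 1 ≤ D * A.card := Nat.mul_pos hD (by omega)
  have h10 : A.card * D = D * A.card := mul_comm _ _
  have h11 : 4 * D * A.card = 4 * (D * A.card) := mul_assoc _ _ _
  omega

/-- Every vertex outside `T` that is not saturated by `U` has a free neighbour with label `o`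
outside `U`. -/
lemma Pseudorandom.exists_free_neighbor {q d d₂ a₀ M R D : ℕ}
    (hG : Pseudorandom G cls q d d₂ a₀ M R D) {o : ℕ} (ho : o < q) {x : V}
    (hx : edgeDegree B x ≤ D) {U : Finset V} (hU : (U.filter fun y => G.Adj x y).card + D < d) :
    ∃ y, cls y = o ∧ y ∉ U ∧ FreeAdj G B x y := by
  by_contra! hcon
  have h1 := hG.degree x o ho
  have hsub : (Finset.univ.filter fun y => G.Adj x y ∧ cls y = o) ⊆
      (U.filter fun y => G.Adj x y) ∪ Finset.univ.filter fun y => s(y, x) ∈ B := by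
    intro y hy
    obtain ⟨-, hxy, hyo⟩ := Finset.mem_filter.1 hy
    by_cases hyU : y ∈ U
    · exact Finset.mem_union_left _ (Finset.mem_filter.2 ⟨hyU, hxy⟩)
    · refine Finset.mem_union_right _ (Finset.mem_filter.2 ⟨Finset.mem_univ _, ?_⟩)
      by_contra hB
      exact hcon y hyo hyU ⟨hxy, by rwa [Sym2.eq_swap]⟩
  have h2 := Finset.card_le_card hsub
  have h3 := Finset.card_union_le (U.filter fun y => G.Adj x y)
    (Finset.univ.filter fun y => s(y, x) ∈ B)
  have h4 := (card_filter_mem_le_edgeDegree B x Finset.univ).trans hx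
  omega

/-- Breaker's edges from a set `S ⊆ T` to vertices with label `o` outside `T`. -/
lemma Pseudorandom.card_mul_le {q d d₂ a₀ M R D : ℕ}
    (hG : Pseudorandom G cls q d d₂ a₀ M R D) {o h : ℕ} (ho : o < q) {S U : Finset V}
    (hST : S ⊆ T) (hTU : T ⊆ U) (hS : ∀ x ∈ S, (U.filter fun y => G.Adj x y).card + h ≤ d)
    (hfree : ∀ x ∈ T, ∀ y ∉ U, cls y = o → G.Adj x y → s(x, y) ∈ B) :
    S.card * h ≤ B.card := by
  set N : V → Finset V := fun x => Finset.univ.filter fun y => G.Adj x y ∧ cls y = o ∧ y ∉ U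
    with hN
  have hNc : ∀ x ∈ S, h ≤ (N x).card := by
    intro x hx
    have h1 := hG.degree x o ho
    have hsub : (Finset.univ.filter fun y => G.Adj x y ∧ cls y = o) ⊆
        (U.filter fun y => G.Adj x y) ∪ N x := by
      intro y hy
      obtain ⟨-, hxy, hyo⟩ := Finset.mem_filter.1 hy
      by_cases hyU : y ∈ U
      · exact Finset.mem_union_left _ (Finset.mem_filter.2 ⟨hyU, hxy⟩)
      · exact Finset.mem_union_right _ (Finset.mem_filter.2 ⟨Finset.mem_univ _, hxy, hyo, hyU⟩)
    have h2 := Finset.card_le_card hsub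
    have h3 := Finset.card_union_le (U.filter fun y => G.Adj x y) (N x)
    have h4 := hS x hx
    omega
  have hinj : (S.sigma N).card ≤ B.card := by
    refine Finset.card_le_card_of_injOn (fun z => s(z.1, z.2)) ?_ ?_
    · rintro ⟨x, y⟩ hz
      simp only [Finset.mem_coe, Finset.mem_sigma, hN, Finset.mem_filter, Finset.mem_univ,
        true_and] at hz
      exact hfree x (hST hz.1) y hz.2.2.2 hz.2.2.1 hz.2.1
    · rintro ⟨x, y⟩ hz ⟨x', y'⟩ hz' heq
      simp only [Finset.mem_coe, Finset.mem_sigma, hN, Finset.mem_filter, Finset.mem_univ,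
        true_and] at hz hz'
      rcases Sym2.eq_iff.1 heq with ⟨rfl, rfl⟩ | ⟨rfl, rfl⟩
      · rfl
      · exact absurd (hTU (hST hz.1)) hz'.2.2.2
  refine le_trans ?_ hinj
  rw [Finset.card_sigma, ← smul_eq_mul]
  exact Finset.card_nsmul_le_sum _ _ _ hNc

variable {q d d₂ a₀ M R D J : ℕ}

/-- Sets of roots of free trees with parameter `j` grow by a factor `D` with each step, until they
have `M` elements. -/
lemma Pseudorandom.exists_freeRoots (hG : Pseudorandom G cls q d d₂ a₀ M R D)
    (hD : 1 ≤ D) (ha₀ : 1 ≤ a₀) (ha₀M : a₀ ≤ M) (ha₀d : a₀ + D ≤ d) (hv : v ∉ T)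
    (hdeg : ∀ u ∉ T, edgeDegree B u ≤ D) (hesc : ¬ CanEscape G J T B v) :
    ∀ j ≤ J, ∀ o, o + numLabels j ≤ q →
      ∃ A : Finset V, A.card = min M (a₀ * D ^ j) ∧ ∀ x ∈ A, FreeRoot G cls B T v j o x := by
  intro j
  induction j with
  | zero =>
    intro _ o ho
    have h1 := hG.degree v o (by rw [numLabels] at ho; omega)
    set A := Finset.univ.filter fun x => cls x = o ∧ x ∉ T ∧ FreeAdj G B x v with hA
    have hsub : (Finset.univ.filter fun x => G.Adj v x ∧ cls x = o) ⊆
        A ∪ Finset.univ.filter fun x => s(x, v) ∈ B := by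
      intro x hx
      obtain ⟨-, hvx, hxo⟩ := Finset.mem_filter.1 hx
      by_cases hB : s(x, v) ∈ B
      · exact Finset.mem_union_right _ (Finset.mem_filter.2 ⟨Finset.mem_univ _, hB⟩)
      · exact Finset.mem_union_left _ (Finset.mem_filter.2 ⟨Finset.mem_univ _, hxo, fun hxT =>
          hB (mem_of_not_canEscape_of_adj hesc hxT hvx.symm), hvx.symm, hB⟩)
    have h2 := Finset.card_le_card hsub
    have h3 := Finset.card_union_le A (Finset.univ.filter fun x => s(x, v) ∈ B)
    have h4 := (card_filter_mem_le_edgeDegree B v Finset.univ).trans (hdeg v hv)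
    obtain ⟨A', hA'A, hA'⟩ := Finset.exists_subset_card_eq
      (show min M (a₀ * D ^ 0) ≤ A.card by rw [pow_zero, mul_one]; omega)
    refine ⟨A', hA', fun x hx => ?_⟩
    obtain ⟨-, rfl, hxT, hxv⟩ := Finset.mem_filter.1 (hA'A hx)
    exact .leaf hxT hxv
  | succ j ih =>
    intro hj o ho
    have hNs : numLabels (j + 1) = 2 + 3 * numLabels j := rfl
    have hN := numLabels_pos j
    obtain ⟨A₁, hA₁, hr₁⟩ := ih (by omega) (o + 2) (by omega)
    obtain ⟨A₂, hA₂, hr₂⟩ := ih (by omega) (o + 2 + numLabels j) (by omega)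
    obtain ⟨A₃, hA₃, hr₃⟩ := ih (by omega) (o + 2 + 2 * numLabels j) (by omega)
    set a := min M (a₀ * D ^ j) with ha
    have haM : a ≤ M := min_le_left _ _
    have ha₀a : a₀ ≤ a := le_min ha₀M (Nat.le_mul_of_pos_right _ (Nat.pow_pos hD))
    have hgrow : min M (a₀ * D ^ (j + 1)) ≤ D * a := by
      rw [ha, Nat.mul_min_mul_left D M _ |>.symm]
      refine min_le_min (Nat.le_mul_of_pos_left _ hD) (le_of_eq ?_)
      ring
    have hdisj : ∀ {o o' : ℕ} {A A' : Finset V}, (∀ x ∈ A, cls x = o) → (∀ x ∈ A', cls x = o') →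
        o ≠ o' → Disjoint A A' := fun h h' hoo => Finset.disjoint_left.2 fun x hx hx' =>
      hoo ((h x hx).symm.trans (h' x hx'))
    -- The set of possible middle vertices `d`.
    have hmid := hG.exists_common hD ha₀ hdeg v (o := o + 1) (by omega) (A := A₁) (A' := A₂)
      (hdisj (fun x hx => (hr₁ x hx).2.2.1) (fun x hx => (hr₂ x hx).2.2.1) (by omega))
      (fun x hx => by rw [(hr₁ x hx).2.2.1]; omega) (fun x hx => by rw [(hr₂ x hx).2.2.1]; omega)
      (hA₂.trans hA₁.symm) (by omega) (by omega) (fun x hx => (hr₁ x hx).1)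
      (fun x hx => (hr₂ x hx).1)
      (fun x hx y hy hxy => mem_of_not_canEscape hesc (by omega) hx (hr₂ y hy) hxy)
    rw [hA₁] at hmid
    obtain ⟨A, hAsub, hA⟩ := Finset.exists_subset_card_eq
      (show a ≤ _ from (Nat.le_mul_of_pos_left a hD).trans hmid)
    have hAm := fun x hx => (Finset.mem_filter.1 (hAsub hx) : x ∈ Finset.univ ∧ _).2
    -- The set of possible roots `c`.
    have htop := hG.exists_common hD ha₀ hdeg v (o := o) (by omega) (A := A) (A' := A₃)
      (hdisj (fun x hx => (hAm x hx).1) (fun x hx => (hr₃ x hx).2.2.1) (by omega))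
      (fun x hx => by rw [(hAm x hx).1]; omega) (fun x hx => by rw [(hr₃ x hx).2.2.1]; omega)
      (hA₃.trans hA.symm) (by omega) (by omega) (fun x hx => (hAm x hx).2.1)
      (fun x hx => (hr₃ x hx).1)
      (fun x hx y hy hxy => mem_of_not_canEscape hesc (by omega) hx (hr₃ y hy) hxy)
    rw [hA] at htop
    obtain ⟨A', hA'sub, hA'⟩ := Finset.exists_subset_card_eq (hgrow.trans htop)
    refine ⟨A', hA', fun c hc => ?_⟩
    obtain ⟨-, hco, hcT, hcv, ⟨d, hd, hcd⟩, ⟨d', hd', hcd'⟩⟩ := Finset.mem_filter.1 (hA'sub hc)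
    obtain ⟨hdo, -, hdv, ⟨e, he, hde⟩, ⟨e', he', hde'⟩⟩ := hAm d hd
    exact .node (hr₁ e he) (hr₂ e' he') (hr₃ d' hd') hcT hcv hco hdv hdo hcd hcd' hde hde'

/-- The untouched vertices with label `o` other than `v` that are not roots of free trees. -/
noncomputable def nonRoots (G : SimpleGraph V) (cls : V → ℕ) (B : Finset (Sym2 V)) (T : Finset V)
    (v : V) (j o : ℕ) : Finset V :=
  Finset.univ.filter fun x => cls x = o ∧ x ∉ T ∧ x ≠ v ∧ ¬ FreeRoot G cls B T v j o x

lemma freeRoot_of_notMem {j o : ℕ} {x : V} (hx : cls x = o) (hxT : x ∉ T) (hxv : x ≠ v)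
    (h : x ∉ nonRoots G cls B T v j o) : FreeRoot G cls B T v j o x := by
  by_contra hr
  exact h (Finset.mem_filter.2 ⟨Finset.mem_univ _, hx, hxT, hxv, hr⟩)

/-- If there are `M` roots of trees with parameter `j` for each label, then nearly all untouched
vertices are roots of trees with parameter `j + 1`. -/
lemma Pseudorandom.card_nonRoots_lt (hG : Pseudorandom G cls q d d₂ a₀ M R D)
    (hdeg : ∀ u ∉ T, edgeDegree B u ≤ D) {j : ℕ}
    (hroots : ∀ o, o + numLabels j ≤ q →
      ∃ A : Finset V, A.card = M ∧ ∀ x ∈ A, FreeRoot G cls B T v j o x)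
    (hT : T.card < M) {o : ℕ} (ho : o + numLabels (j + 1) ≤ q) :
    (nonRoots G cls B T v (j + 1) o).card < 2 * M := by
  have hNs : numLabels (j + 1) = 2 + 3 * numLabels j := rfl
  have hN := numLabels_pos j
  obtain ⟨A₁, hA₁, hr₁⟩ := hroots (o + 2) (by omega)
  obtain ⟨A₂, hA₂, hr₂⟩ := hroots (o + 2 + numLabels j) (by omega)
  obtain ⟨A₃, hA₃, hr₃⟩ := hroots (o + 2 + 2 * numLabels j) (by omega)
  have hbad : ∀ {o o' : ℕ} {A : Finset V}, A.card = M → (∀ x ∈ A, cls x = o' ∧ x ∉ T) → o ≠ o' →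
      (Finset.univ.filter fun x => cls x = o ∧ ¬ ∃ y ∈ A, FreeAdj G B x y).card < M := by
    intro o o' A hA hAl hoo
    by_contra hcon
    obtain ⟨S, hSsub, hS⟩ := Finset.exists_subset_card_eq (not_lt.1 hcon)
    have hSm : ∀ x ∈ S, cls x = o ∧ ¬ ∃ y ∈ A, FreeAdj G B x y := fun x hx =>
      (Finset.mem_filter.1 (hSsub hx)).2
    obtain ⟨x, hx, y, hy, hxy⟩ := hG.exists_freeAdj hdeg hA hS
      (Finset.disjoint_left.2 fun x hx hx' => hoo ((hSm x hx).1.symm.trans (hAl x hx').1))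
      (fun x hx => (hAl x hx).2)
    exact (hSm x hx).2 ⟨y, hy, hxy⟩
  set mid := Finset.univ.filter fun x => cls x = o + 1 ∧ x ∉ T ∧ x ≠ v ∧
    (∃ y ∈ A₁, FreeAdj G B x y) ∧ ∃ y ∈ A₂, FreeAdj G B x y with hmid
  have hmidc : M ≤ mid.card := by
    have b₁ := hbad (o := o + 1) hA₁ (fun x hx => ⟨(hr₁ x hx).2.2.1, (hr₁ x hx).1⟩) (by omega)
    have b₂ := hbad (o := o + 1) hA₂ (fun x hx => ⟨(hr₂ x hx).2.2.1, (hr₂ x hx).1⟩) (by omega)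
    have hs := hG.size (o + 1) (by omega)
    set F₁ := Finset.univ.filter fun x => cls x = o + 1 ∧ ¬ ∃ y ∈ A₁, FreeAdj G B x y
    set F₂ := Finset.univ.filter fun x => cls x = o + 1 ∧ ¬ ∃ y ∈ A₂, FreeAdj G B x y
    have hsub : (Finset.univ.filter fun x => cls x = o + 1) ⊆ mid ∪ (F₁ ∪ (F₂ ∪ (T ∪ {v}))) := by
      intro x hx
      have hx := (Finset.mem_filter.1 hx).2
      simp only [mid, F₁, F₂, Finset.mem_union, Finset.mem_filter, Finset.mem_univ, true_and, hx,
        Finset.mem_singleton]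
      by_cases h₁ : ∃ y ∈ A₁, FreeAdj G B x y <;> by_cases h₂ : ∃ y ∈ A₂, FreeAdj G B x y <;>
        by_cases h₃ : x ∈ T <;> by_cases h₄ : x = v <;> simp [h₁, h₂, h₃, h₄]
    have c₁ := Finset.card_le_card hsub
    have c₂ := Finset.card_union_le mid (F₁ ∪ (F₂ ∪ (T ∪ {v})))
    have c₃ := Finset.card_union_le F₁ (F₂ ∪ (T ∪ {v}))
    have c₄ := Finset.card_union_le F₂ (T ∪ {v})
    have c₅ := Finset.card_union_le T {v}
    rw [Finset.card_singleton] at c₅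
    omega
  obtain ⟨A, hAsub, hA⟩ := Finset.exists_subset_card_eq hmidc
  have hAm := fun x hx => (Finset.mem_filter.1 (hAsub hx) : x ∈ Finset.univ ∧ _).2
  have b₁ := hbad (o := o) hA (fun x hx => ⟨(hAm x hx).1, (hAm x hx).2.1⟩) (by omega)
  have b₂ := hbad (o := o) hA₃ (fun x hx => ⟨(hr₃ x hx).2.2.1, (hr₃ x hx).1⟩) (by omega)
  have hsub : nonRoots G cls B T v (j + 1) o ⊆
      (Finset.univ.filter fun x => cls x = o ∧ ¬ ∃ y ∈ A, FreeAdj G B x y) ∪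
      Finset.univ.filter fun x => cls x = o ∧ ¬ ∃ y ∈ A₃, FreeAdj G B x y := by
    intro c hc
    obtain ⟨-, hco, hcT, hcv, hnr⟩ := Finset.mem_filter.1 hc
    by_contra hcon
    simp only [Finset.mem_union, Finset.mem_filter, Finset.mem_univ, true_and, hco, not_or,
      not_not] at hcon
    obtain ⟨⟨d, hd, hcd⟩, ⟨d', hd', hcd'⟩⟩ := hcon
    obtain ⟨hdo, -, hdv, ⟨e, he, hde⟩, ⟨e', he', hde'⟩⟩ := hAm d hd
    exact hnr (.node (hr₁ e he) (hr₂ e' he') (hr₃ d' hd') hcT hcv hco hdv hdo hcd hcd' hde hde')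
  have := Finset.card_le_card hsub
  have := this.trans (Finset.card_union_le _ _)
  omega

/-- If nearly all untouched vertices are roots of trees with parameter `j`, and few vertices are
touched, then all but very few untouched vertices are roots of trees with parameter `j + 1`. -/
lemma Pseudorandom.card_nonRoots_succ_lt (hG : Pseudorandom G cls q d d₂ a₀ M R D)
    (hd₂ : d₂ + D ≤ d) (hRd : 4 * R + D + 1 ≤ d) (hdeg : ∀ u ∉ T, edgeDegree B u ≤ D) {j : ℕ}
    (hnon : ∀ o, o + numLabels j ≤ q → (nonRoots G cls B T v j o).card < 2 * M)
    (hT : T.card < M) (hTR : T.card < 2 * R) {o : ℕ} (ho : o + numLabels (j + 1) ≤ q) :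
    (nonRoots G cls B T v (j + 1) o).card < R := by
  have hNs : numLabels (j + 1) = 2 + 3 * numLabels j := rfl
  have hN := numLabels_pos j
  -- Vertices saturated by touched vertices and non-roots with a given label.
  set sat : ℕ → Finset V := fun o => Finset.univ.filter fun x =>
    d₂ ≤ ((insert v (T ∪ nonRoots G cls B T v j o)).filter fun y => G.Adj x y).card with hsat
  have hsatc : ∀ o, o + numLabels j ≤ q → (sat o).card < R := by
    intro o ho
    refine hG.concentrated _ ((Finset.card_insert_le _ _).trans ?_)
    have := Finset.card_union_le T (nonRoots G cls B T v j o)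
    have := hnon o ho
    omega
  have hnext : ∀ o, o + numLabels j ≤ q → ∀ x ∉ T, x ∉ sat o →
      ∃ y, FreeRoot G cls B T v j o y ∧ FreeAdj G B x y := by
    intro o ho x hxT hx
    have hx' : ¬ d₂ ≤ _ := fun h => hx (Finset.mem_filter.2 ⟨Finset.mem_univ _, h⟩)
    obtain ⟨y, hyo, hyU, hxy⟩ := hG.exists_free_neighbor (o := o) (by omega) (hdeg x hxT)
      (U := insert v (T ∪ nonRoots G cls B T v j o)) (by omega)
    simp only [Finset.mem_insert, Finset.mem_union, not_or] at hyU
    exact ⟨y, freeRoot_of_notMem hyo hyU.2.1 hyU.1 hyU.2.2, hxy⟩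
  have s₁ := hsatc (o + 2) (by omega)
  have s₂ := hsatc (o + 2 + numLabels j) (by omega)
  have s₃ := hsatc (o + 2 + 2 * numLabels j) (by omega)
  refine lt_of_le_of_lt (Finset.card_le_card fun c hc => ?_) s₃
  obtain ⟨-, hco, hcT, hcv, hnr⟩ := Finset.mem_filter.1 hc
  by_contra hcs
  obtain ⟨d', hd', hcd'⟩ := hnext _ (by omega) c hcT hcs
  set U := insert v (T ∪ (sat (o + 2) ∪ sat (o + 2 + numLabels j))) with hU
  have hUc : U.card + D < d := by
    have u₁ := Finset.card_insert_le v (T ∪ (sat (o + 2) ∪ sat (o + 2 + numLabels j)))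
    have u₂ := Finset.card_union_le T (sat (o + 2) ∪ sat (o + 2 + numLabels j))
    have u₃ := Finset.card_union_le (sat (o + 2)) (sat (o + 2 + numLabels j))
    rw [← hU] at u₁
    omega
  obtain ⟨d, hdo, hdU, hcd⟩ := hG.exists_free_neighbor (o := o + 1) (by omega) (hdeg c hcT)
    (U := U) (lt_of_le_of_lt (Nat.add_le_add_right (Finset.card_filter_le _ _) _) hUc)
  simp only [hU, Finset.mem_insert, Finset.mem_union, not_or] at hdU
  obtain ⟨hdv, hdT, hd₁, hd₂⟩ := hdU
  obtain ⟨e, he, hde⟩ := hnext _ (by omega) d hdT hd₁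
  obtain ⟨e', he', hde'⟩ := hnext _ (by omega) d hdT hd₂
  exact hnr (.node he he' hd' hcT hcv hco hdv hdo hcd hcd' hde hde')

/-- In a pseudorandom graph, Connector can always head for any untouched vertex. -/
lemma Pseudorandom.canEscape {j K : ℕ} {w : V} (hG : Pseudorandom G cls q d d₂ a₀ M R D)
    (hq : numLabels (j + 2) ≤ q) (hD : 1 ≤ D) (ha₀ : 1 ≤ a₀) (ha₀M : a₀ ≤ M) (ha₀d : a₀ + D ≤ d)
    (hgrow : M ≤ a₀ * D ^ j) (hd₂ : d₂ + D ≤ d) (hRd : 4 * R + D + 1 ≤ d) (hKd : K + 3 * R < d)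
    (hKd₂ : 2 * K + d₂ < d) (hw : w ∈ T) (hv : v ∉ T) (hdeg : ∀ u ∉ T, edgeDegree B u ≤ D)
    (hB : B.card ≤ K * T.card) : CanEscape G (j + 2) T B v := by
  by_contra hesc
  have hq₁ : numLabels (j + 2) = 2 + 3 * numLabels (j + 1) := rfl
  have hq₀ : numLabels (j + 1) = 2 + 3 * numLabels j := rfl
  have hTpos : 0 < T.card := Finset.card_pos.2 ⟨w, hw⟩
  have hroots : ∀ o, o + numLabels j ≤ q →
      ∃ A : Finset V, A.card = M ∧ ∀ x ∈ A, FreeRoot G cls B T v j o x := by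
    intro o ho
    obtain ⟨A, hA, hr⟩ := hG.exists_freeRoots hD ha₀ ha₀M ha₀d hv hdeg hesc j (by omega) o ho
    exact ⟨A, by rw [hA]; omega, hr⟩
  -- `T` is small, since otherwise it has a free edge to a large set of roots.
  have hTM : T.card < M := by
    by_contra! hTM
    obtain ⟨A, hA, hr⟩ := hroots 0 (by omega)
    obtain ⟨S, hST, hS⟩ := Finset.exists_subset_card_eq hTM
    obtain ⟨x, hx, y, hy, hxy⟩ := hG.exists_freeAdj hdeg hA hS
      (Finset.disjoint_left.2 fun x hx hx' => (hr x hx').1 (hST hx)) (fun x hx => (hr x hx).1)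
    exact hxy.2 (mem_of_not_canEscape hesc (by omega) (hST hx) (hr y hy) hxy.1)
  have hnon : ∀ o, o + numLabels (j + 1) ≤ q → (nonRoots G cls B T v (j + 1) o).card < 2 * M :=
    fun o ho => hG.card_nonRoots_lt hdeg hroots hTM ho
  have hmem : ∀ i ≤ j + 2, ∀ x ∈ T, ∀ y ∉ insert v (T ∪ nonRoots G cls B T v i 0), cls y = 0 →
      G.Adj x y → s(x, y) ∈ B := by
    intro i hi x hx y hy hy0 hxy
    simp only [Finset.mem_insert, Finset.mem_union, not_or] at hy
    exact mem_of_not_canEscape hesc hi hx (freeRoot_of_notMem hy0 hy.2.1 hy.1 hy.2.2) hxy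
  have hTU : ∀ i, T ⊆ insert v (T ∪ nonRoots G cls B T v i 0) := fun i x hx => by simp [hx]
  have hUc : ∀ i, (insert v (T ∪ nonRoots G cls B T v i 0)).card ≤
      T.card + (nonRoots G cls B T v i 0).card + 1 := fun i =>
    (Finset.card_insert_le _ _).trans (Nat.add_le_add_right (Finset.card_union_le _ _) _)
  rcases lt_or_ge T.card (2 * R) with hTR | hTR
  · have hn : (nonRoots G cls B T v (j + 2) 0).card < R :=
      hG.card_nonRoots_succ_lt hd₂ hRd hdeg hnon hTM hTR (by rwa [Nat.zero_add])
    have h1 := hG.card_mul_le (o := 0) (h := d - 3 * R) (by omega) (subset_refl T) (hTU (j + 2))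
      (fun x _ => by
        have := Finset.card_filter_le (insert v (T ∪ nonRoots G cls B T v (j + 2) 0))
          (fun y => G.Adj x y)
        have := hUc (j + 2)
        omega) (hmem _ le_rfl)
    have h2 : T.card * (K + 1) ≤ T.card * (d - 3 * R) := Nat.mul_le_mul_left _ (by omega)
    have h3 : T.card * (K + 1) = K * T.card + T.card := by ring
    omega
  · set U := insert v (T ∪ nonRoots G cls B T v (j + 1) 0) with hU
    have hn := hnon 0 (by omega)
    have hUc' := hUc (j + 1)
    rw [← hU] at hUc'
    have hconc := hG.concentrated U (by omega)
    set sat := Finset.univ.filter fun x => d₂ ≤ (U.filter fun y => G.Adj x y).card with hsat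
    have h1 := hG.card_mul_le (o := 0) (h := d - d₂) (by omega)
      (Finset.sdiff_subset : T \ sat ⊆ T) (hTU (j + 1))
      (fun x hx => by
        have : ¬ d₂ ≤ (U.filter fun y => G.Adj x y).card := fun h => (Finset.mem_sdiff.1 hx).2
          (Finset.mem_filter.2 ⟨Finset.mem_univ _, h⟩)
        rw [← hU]
        omega) (hmem _ (by omega))
    have h2 := Finset.le_card_sdiff sat T
    have h3 : (T \ sat).card * (2 * K + 1) ≤ (T \ sat).card * (d - d₂) :=
      Nat.mul_le_mul_left _ (by omega)
    have h4 : T.card * K ≤ 2 * (T \ sat).card * K := Nat.mul_le_mul_right _ (by omega)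
    have h5 : (T \ sat).card * (2 * K + 1) = 2 * (T \ sat).card * K + (T \ sat).card := by ring
    have h6 : K * T.card = T.card * K := mul_comm _ _
    omega

end Existence

end ConnectorBreaker

namespace ConnectorBreaker

open scoped Classical

/-! ### Independence and exponential moments -/

section Expectation

variable {α ι : Type*} {p : ℝ} {E : Finset α}

/-- The expectation of `f` at the random subset of `E` that contains each element independently
with probability `p`. -/
noncomputable def expect (p : ℝ) (E : Finset α) (f : Finset α → ℝ) : ℝ :=
  ∑ S ∈ E.powerset, p ^ S.card * (1 - p) ^ (E.card - S.card) * f S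

lemma expect_const (p : ℝ) (E : Finset α) (c : ℝ) : expect p E (fun _ => c) = c := by
  rw [expect, ← Finset.sum_mul, Finset.sum_pow_mul_eq_add_pow]
  simp

lemma expect_const_sub_mul (c t : ℝ) (f : Finset α → ℝ) :
    expect p E (fun S => c - t * f S) = c - t * expect p E f := by
  conv_rhs => rw [← expect_const p E c]
  simp only [expect, Finset.mul_sum, ← Finset.sum_sub_distrib]
  exact Finset.sum_congr rfl fun S _ => by ring

lemma expect_congr {f g : Finset α → ℝ} (h : ∀ S ⊆ E, f S = g S) :
    expect p E f = expect p E g :=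
  Finset.sum_congr rfl fun S hS => by rw [h S (Finset.mem_powerset.1 hS)]

lemma expect_nonneg (h₀ : 0 ≤ p) (h₁ : p ≤ 1) {f : Finset α → ℝ} (hf : ∀ S, 0 ≤ f S) :
    0 ≤ expect p E f :=
  Finset.sum_nonneg fun S _ => mul_nonneg
    (mul_nonneg (pow_nonneg h₀ _) (pow_nonneg (sub_nonneg.2 h₁) _)) (hf S)

lemma expect_const_mul (c : ℝ) (f : Finset α → ℝ) :
    expect p E (fun S => c * f S) = c * expect p E f := by
  simp only [expect, Finset.mul_sum]
  exact Finset.sum_congr rfl fun S _ => by ring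

variable [DecidableEq α]

/-- Functions of disjoint parts of the random set are independent. -/
lemma expect_mul_split {F : Finset α} (hF : F ⊆ E) {f g : Finset α → ℝ}
    (hf : ∀ S, f S = f (S ∩ F)) (hg : ∀ S, g S = g (S \ F)) :
    expect p E (fun S => f S * g S) = expect p F f * expect p (E \ F) g := by
  rw [expect, expect, expect, Finset.sum_mul_sum, ← Finset.sum_product']
  refine Finset.sum_nbij' (fun S => (S ∩ F, S \ F)) (fun z => z.1 ∪ z.2) ?_ ?_ ?_ ?_ ?_
  · intro S hS
    rw [Finset.mem_powerset] at hS
    simp only [Finset.mem_product, Finset.mem_powerset]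
    exact ⟨Finset.inter_subset_right, Finset.sdiff_subset_sdiff hS subset_rfl⟩
  · rintro ⟨S, S'⟩ hS
    simp only [Finset.mem_product, Finset.mem_powerset] at hS ⊢
    exact Finset.union_subset (hS.1.trans hF) (hS.2.trans Finset.sdiff_subset)
  · intro S _
    rw [Finset.union_comm]
    exact Finset.sdiff_union_inter S F
  · rintro ⟨S, S'⟩ hS
    simp only [Finset.mem_product, Finset.mem_powerset] at hS
    have h1 : Disjoint S' F := Finset.disjoint_of_subset_left hS.2 Finset.sdiff_disjoint
    ext x
    · simp only [Finset.mem_inter, Finset.mem_union]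
      have h2 := @hS.1 x
      have h3 : x ∈ S' → x ∉ F := fun h => Finset.disjoint_left.1 h1 h
      tauto
    · simp only [Finset.mem_sdiff, Finset.mem_union]
      have h2 := @hS.1 x
      have h3 : x ∈ S' → x ∉ F := fun h => Finset.disjoint_left.1 h1 h
      tauto
  · intro S hS
    rw [Finset.mem_powerset] at hS
    have c₁ : (S ∩ F).card + (S \ F).card = S.card := Finset.card_inter_add_card_sdiff S F
    have c₂ : (E \ F).card + F.card = E.card := Finset.card_sdiff_add_card_eq_card hF
    have c₃ : (S ∩ F).card ≤ F.card := Finset.card_le_card Finset.inter_subset_right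
    have c₄ : (S \ F).card ≤ (E \ F).card :=
      Finset.card_le_card (Finset.sdiff_subset_sdiff hS subset_rfl)
    rw [hf S, hg S, ← c₁, show E.card - ((S ∩ F).card + (S \ F).card) =
      (F.card - (S ∩ F).card) + ((E \ F).card - (S \ F).card) by omega, pow_add, pow_add]
    ring

lemma expect_eq_of_subset {F : Finset α} (hF : F ⊆ E) {f : Finset α → ℝ}
    (hf : ∀ S, f S = f (S ∩ F)) : expect p E f = expect p F f := by
  have := expect_mul_split (p := p) hF hf (g := fun _ => 1) (fun _ => rfl)
  simpa [expect_const] using this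

lemma expect_mul {F : Finset α} (hF : F ⊆ E) {f g : Finset α → ℝ}
    (hf : ∀ S, f S = f (S ∩ F)) (hg : ∀ S, g S = g (S \ F)) :
    expect p E (fun S => f S * g S) = expect p E f * expect p E g := by
  rw [expect_mul_split hF hf hg, expect_eq_of_subset hF hf]
  congr 1
  have := expect_mul_split (p := p) hF (f := fun _ => 1) (fun _ => rfl) hg
  simpa [expect_const] using this.symm

/-- Functions of pairwise disjoint parts of the random set are independent. -/
lemma expect_prod (X : Finset ι) (F : ι → Finset α) (f : ι → Finset α → ℝ)
    (hFE : ∀ x ∈ X, F x ⊆ E) (hdisj : (X : Set ι).PairwiseDisjoint F)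
    (hf : ∀ x ∈ X, ∀ S, f x S = f x (S ∩ F x)) :
    expect p E (fun S => ∏ x ∈ X, f x S) = ∏ x ∈ X, expect p E (f x) := by
  induction X using Finset.induction_on with
  | empty => simp [expect_const]
  | insert x X hx ih =>
    simp only [Finset.prod_insert hx]
    rw [expect_mul (hFE x (Finset.mem_insert_self _ _)) (hf x (Finset.mem_insert_self _ _)), ih]
    · exact fun y hy => hFE y (Finset.mem_insert_of_mem hy)
    · exact hdisj.subset (by simp)
    · exact fun y hy => hf y (Finset.mem_insert_of_mem hy)
    · intro S
      refine Finset.prod_congr rfl fun y hy => ?_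
      rw [hf y (Finset.mem_insert_of_mem hy) S, hf y (Finset.mem_insert_of_mem hy) (S \ F x)]
      congr 1
      have hd : Disjoint (F x) (F y) := hdisj (by simp) (by simp [hy])
        (fun h => hx (h ▸ hy))
      ext e
      have he : e ∈ F y → e ∉ F x := fun h => Finset.disjoint_right.1 hd h
      simp only [Finset.mem_inter, Finset.mem_sdiff]
      exact ⟨fun h => ⟨⟨h.1, he h.2⟩, h.2⟩, fun h => ⟨h.1.1, h.2⟩⟩

/-- The moment generating function of the number of random elements in `F`. -/
lemma expect_prod_ite {F : Finset α} (hF : F ⊆ E) (t : ℝ) :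
    expect p E (fun S => ∏ e ∈ F, if e ∈ S then t else 1) = (1 - p + p * t) ^ F.card := by
  rw [expect_prod F (fun e => {e}) (fun e S => if e ∈ S then t else 1)
    (fun e he => by simpa using hF he) (fun a _ b _ hab => by simpa using hab)
    (fun e _ S => by simp), Finset.prod_congr rfl, Finset.prod_const]
  intro e he
  rw [expect_eq_of_subset (Finset.singleton_subset_iff.2 (hF he)) (fun S => by simp), expect]
  have : ({e} : Finset α).powerset = {∅, {e}} := by
    ext S
    simp [Finset.subset_singleton_iff]
  rw [this, Finset.sum_pair (by simp [Finset.ext_iff])]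
  simp

lemma prod_ite_mem (F S : Finset α) (t : ℝ) :
    (∏ e ∈ F, if e ∈ S then t else 1) = t ^ (F.filter (· ∈ S)).card := by
  rw [Finset.prod_ite, Finset.prod_const, Finset.prod_const_one, mul_one]

/-- The probability that the random set meets `F`. -/
lemma expect_exists {F : Finset α} (hF : F ⊆ E) :
    expect p E (fun S => if ∃ e ∈ F, e ∈ S then 1 else 0) = 1 - (1 - p) ^ F.card := by
  have h := expect_prod_ite (p := p) hF 0
  rw [mul_zero, add_zero] at h
  rw [← h]
  have := expect_const_sub_mul (p := p) (E := E) 1 1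
    (fun S => ∏ e ∈ F, if e ∈ S then (0 : ℝ) else 1)
  rw [one_mul] at this
  rw [← this]
  refine expect_congr fun S _ => ?_
  split_ifs with hex
  · obtain ⟨e, heF, heS⟩ := hex
    rw [Finset.prod_eq_zero heF (by simp [heS])]
    simp
  · push Not at hex
    rw [Finset.prod_eq_one fun e he => by simp [hex e he]]
    simp

lemma div_one_add_le_one_sub_pow (h₀ : 0 ≤ p) (h₁ : p ≤ 1) (a : ℕ) :
    p * a / (1 + p * a) ≤ 1 - (1 - p) ^ a := by
  have hz : 0 ≤ p * a := by positivity
  have h2 : (1 - p) ^ a ≤ Real.exp (-(p * a)) := by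
    calc (1 - p) ^ a ≤ (Real.exp (-p)) ^ a :=
          pow_le_pow_left₀ (by linarith) (Real.one_sub_le_exp_neg p) a
      _ = Real.exp (-(p * a)) := by rw [← Real.exp_nat_mul]; congr 1; ring
  have h3 : Real.exp (-(p * a)) ≤ 1 / (1 + p * a) := by
    rw [Real.exp_neg, ← one_div]
    exact one_div_le_one_div_of_le (by positivity) (by linarith [Real.add_one_le_exp (p * a)])
  have h4 : p * a / (1 + p * a) = 1 - 1 / (1 + p * a) := by field_simp; ring
  linarith

/-- The exponential moment behind the lower tail for the number of `x` whose two edge sets `F x`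
and `F' x` are both met by the random set. -/
lemma expect_prod_both_le (h₀ : 0 ≤ p) (h₁ : p ≤ 1) (X : Finset ι) (F F' : ι → Finset α) (a : ℕ)
    (hF : ∀ x ∈ X, F x ⊆ E) (hF' : ∀ x ∈ X, F' x ⊆ E)
    (ha : ∀ x ∈ X, (F x).card = a) (ha' : ∀ x ∈ X, (F' x).card = a)
    (hFF : ∀ x ∈ X, Disjoint (F x) (F' x))
    (hdisj : (X : Set ι).PairwiseDisjoint fun x => F x ∪ F' x) :
    expect p E (fun S => ∏ x ∈ X,
        if (∃ e ∈ F x, e ∈ S) ∧ ∃ e ∈ F' x, e ∈ S then (1 / 2 : ℝ) else 1) ≤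
      Real.exp (-(X.card * (p * a / (1 + p * a)) ^ 2 / 2)) := by
  rw [expect_prod X (fun x => F x ∪ F' x) (fun x S =>
    if (∃ e ∈ F x, e ∈ S) ∧ ∃ e ∈ F' x, e ∈ S then (1 / 2 : ℝ) else 1)
    (fun x hx => Finset.union_subset (hF x hx) (hF' x hx)) hdisj]
  · have hone : ∀ x ∈ X, expect p E (fun S =>
        if (∃ e ∈ F x, e ∈ S) ∧ ∃ e ∈ F' x, e ∈ S then (1 / 2 : ℝ) else 1) ≤
        Real.exp (-((p * a / (1 + p * a)) ^ 2 / 2)) := by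
      intro x hx
      have e1 : expect p E (fun S =>
          if (∃ e ∈ F x, e ∈ S) ∧ ∃ e ∈ F' x, e ∈ S then (1 / 2 : ℝ) else 1) =
          1 - 1 / 2 * (1 - (1 - p) ^ a) ^ 2 := by
        have q₁ := expect_exists (p := p) (hF x hx)
        have q₂ := expect_exists (p := p) (hF' x hx)
        rw [ha x hx] at q₁
        rw [ha' x hx] at q₂
        rw [pow_two]
        nth_rewrite 1 [← q₁]
        rw [← q₂, ← expect_mul (F := F x) (hF x hx), ← expect_const_sub_mul]
        · refine expect_congr fun S _ => ?_
          by_cases h₁ : ∃ e ∈ F x, e ∈ S <;> by_cases h₂ : ∃ e ∈ F' x, e ∈ S <;>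
            simp only [h₁, h₂, and_self, and_true, and_false, if_true, if_false] <;> norm_num
        · intro S
          congr 1
          simp only [Finset.mem_inter, eq_iff_iff]
          exact exists_congr fun e => by tauto
        · intro S
          congr 1
          simp only [Finset.mem_sdiff, eq_iff_iff]
          refine exists_congr fun e => ?_
          have he : e ∈ F' x → e ∉ F x := fun h => Finset.disjoint_right.1 (hFF x hx) h
          exact ⟨fun h => ⟨h.1, h.2, he h.1⟩, fun h => ⟨h.1, h.2.1⟩⟩
      rw [e1]
      have h2 := div_one_add_le_one_sub_pow h₀ h₁ a
      have h3 : 0 ≤ p * a / (1 + p * a) := by positivity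
      have h4 : (p * a / (1 + p * a)) ^ 2 ≤ (1 - (1 - p) ^ a) ^ 2 := pow_le_pow_left₀ h3 h2 2
      refine le_trans ?_ (Real.one_sub_le_exp_neg _)
      linarith
    calc _ ≤ ∏ _x ∈ X, Real.exp (-((p * a / (1 + p * a)) ^ 2 / 2)) := by
          refine Finset.prod_le_prod (fun x _ => expect_nonneg h₀ h₁ fun S => ?_) hone
          split_ifs <;> norm_num
      _ = _ := by
          rw [Finset.prod_const, ← Real.exp_nat_mul]
          congr 1
          ring
  · intro x _ S
    have key : ∀ F₁ F₂ : Finset α, F₁ ⊆ F₂ → ((∃ e ∈ F₁, e ∈ S) ↔ ∃ e ∈ F₁, e ∈ S ∩ F₂) := by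
      intro F₁ F₂ h
      refine exists_congr fun e => ?_
      have := @h e
      rw [Finset.mem_inter]
      tauto
    simp only [key _ _ (Finset.subset_union_left : F x ⊆ F x ∪ F' x),
      key _ _ (Finset.subset_union_right : F' x ⊆ F x ∪ F' x)]

end Expectation

/-! ### Tail bounds for the binomial random graph -/

section RandomGraph

open MeasureTheory unitInterval SimpleGraph

variable {V : Type*} [Fintype V] [DecidableEq V] {p : I}

/-- First moment bound for events of the binomial random graph. -/
lemma binomialRandom_le_expect (P : SimpleGraph V → Prop) (f : Finset (Sym2 V) → ℝ)
    (hf : ∀ S, 0 ≤ f S) (hP : ∀ G, P G → 1 ≤ f G.edgeFinset) :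
    binomialRandom V p {G | P G} ≤
      ENNReal.ofReal (expect p (⊤ : SimpleGraph V).edgeFinset f) := by
  have hp₀ : (0 : ℝ) ≤ p := p.2.1
  have hp₁ : (p : ℝ) ≤ 1 := p.2.2
  set N := (⊤ : SimpleGraph V).edgeFinset.card with hN
  have hNc : N = (Nat.card V).choose 2 := by
    rw [hN, card_edgeFinset_top_eq_card_choose_two, Nat.card_eq_fintype_card]
  have hterm : ∀ S : Finset (Sym2 V), 0 ≤ (p : ℝ) ^ S.card * (1 - p) ^ (N - S.card) * f S :=
    fun S => mul_nonneg (mul_nonneg (pow_nonneg hp₀ _) (pow_nonneg (sub_nonneg.2 hp₁) _)) (hf S)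
  calc binomialRandom V p {G | P G}
      ≤ binomialRandom V p (⋃ G ∈ Finset.univ.filter P, {G}) := by
        refine measure_mono fun G hG => ?_
        simpa using hG
    _ ≤ ∑ G ∈ Finset.univ.filter P, binomialRandom V p {G} := measure_biUnion_finset_le _ _
    _ ≤ ∑ G ∈ Finset.univ.filter P, ENNReal.ofReal ((p : ℝ) ^ G.edgeFinset.card *
          (1 - p) ^ (N - G.edgeFinset.card) * f G.edgeFinset) := by
        refine Finset.sum_le_sum fun G hG => ?_
        have e1 : G.edgeSet.ncard = G.edgeFinset.card := by
          rw [← coe_edgeFinset, Set.ncard_coe_finset]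
        have e2 : ((toNNReal p : NNReal) : ENNReal) = ENNReal.ofReal p := by
          rw [ENNReal.ofReal_eq_coe_nnreal hp₀]; rfl
        have e3 : ((toNNReal (σ p) : NNReal) : ENNReal) = ENNReal.ofReal (1 - p) := by
          rw [ENNReal.ofReal_eq_coe_nnreal (sub_nonneg.2 hp₁)]; rfl
        rw [binomialRandom_singleton, e1, e2, e3, ← hNc, ← ENNReal.ofReal_pow hp₀,
          ← ENNReal.ofReal_pow (sub_nonneg.2 hp₁), ← ENNReal.ofReal_mul (pow_nonneg hp₀ _)]
        refine ENNReal.ofReal_le_ofReal (le_mul_of_one_le_right ?_ ?_)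
        · exact mul_nonneg (pow_nonneg hp₀ _) (pow_nonneg (sub_nonneg.2 hp₁) _)
        · exact hP G (Finset.mem_filter.1 hG).2
    _ = ENNReal.ofReal (∑ G ∈ Finset.univ.filter P, ((p : ℝ) ^ G.edgeFinset.card *
          (1 - p) ^ (N - G.edgeFinset.card) * f G.edgeFinset)) :=
        (ENNReal.ofReal_sum_of_nonneg fun G _ => hterm _).symm
    _ ≤ ENNReal.ofReal (expect p (⊤ : SimpleGraph V).edgeFinset f) := by
        refine ENNReal.ofReal_le_ofReal ?_
        rw [expect, ← Finset.sum_image (s := Finset.univ.filter P) (g := fun G => G.edgeFinset)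
          (f := fun S => (p : ℝ) ^ S.card * (1 - p) ^ (N - S.card) * f S)
          (fun G _ G' _ h => edgeFinset_inj.1 h)]
        refine Finset.sum_le_sum_of_subset_of_nonneg ?_ fun S _ _ => hterm S
        intro S hS
        obtain ⟨G, -, rfl⟩ := Finset.mem_image.1 hS
        exact Finset.mem_powerset.2 (edgeFinset_mono le_top)

lemma one_le_exp_mul_half_pow {k m : ℕ} {b : ℝ} (hk : k ≤ m) (hb : (m : ℝ) ≤ b) :
    1 ≤ Real.exp b * (1 / 2) ^ k := by
  have h1 : (2 : ℝ) ^ k ≤ Real.exp b := by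
    calc (2 : ℝ) ^ k ≤ (Real.exp 1) ^ k :=
          pow_le_pow_left₀ (by norm_num) (by linarith [Real.add_one_le_exp (1 : ℝ)]) k
      _ = Real.exp k := by rw [← Real.exp_nat_mul, mul_one]
      _ ≤ Real.exp b := Real.exp_le_exp.2 (le_trans (by exact_mod_cast hk) hb)
  rw [one_div, inv_pow, ← div_eq_mul_inv, one_le_div (by positivity)]
  exact h1

/-- Lower tail for the number of edges of the random graph in `F`. -/
lemma binomialRandom_card_le {F : Finset (Sym2 V)} (hF : F ⊆ (⊤ : SimpleGraph V).edgeFinset)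
    (m : ℕ) :
    binomialRandom V p {G | (F.filter (· ∈ G.edgeSet)).card ≤ m} ≤
      ENNReal.ofReal (Real.exp (m - p * F.card / 2)) := by
  refine (binomialRandom_le_expect _
    (fun S => Real.exp m * ∏ e ∈ F, if e ∈ S then (1 / 2 : ℝ) else 1) (fun S => ?_)
    fun G hG => ?_).trans (ENNReal.ofReal_le_ofReal ?_)
  · refine mul_nonneg (Real.exp_pos _).le (Finset.prod_nonneg fun e _ => ?_)
    split_ifs <;> norm_num
  · rw [prod_ite_mem]
    simp only [mem_edgeFinset]
    exact one_le_exp_mul_half_pow hG le_rfl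
  · rw [expect_const_mul, expect_prod_ite hF, sub_eq_add_neg (m : ℝ), Real.exp_add]
    refine mul_le_mul_of_nonneg_left ?_ (Real.exp_pos _).le
    have hp₁ : (p : ℝ) ≤ 1 := p.2.2
    calc (1 - (p : ℝ) + p * (1 / 2)) ^ F.card ≤ (Real.exp (-(p / 2))) ^ F.card := by
          refine pow_le_pow_left₀ (by linarith [p.2.1]) ?_ _
          linarith [Real.one_sub_le_exp_neg ((p : ℝ) / 2)]
      _ = _ := by rw [← Real.exp_nat_mul]; congr 1; ring

/-- Upper tail for the number of edges of the random graph in `F`. -/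
lemma binomialRandom_le_card {F : Finset (Sym2 V)} (hF : F ⊆ (⊤ : SimpleGraph V).edgeFinset)
    (m : ℕ) :
    binomialRandom V p {G | m ≤ (F.filter (· ∈ G.edgeSet)).card} ≤
      ENNReal.ofReal (Real.exp (p * F.card - m / 2)) := by
  refine (binomialRandom_le_expect _
    (fun S => Real.exp (-(m / 2)) * ∏ e ∈ F, if e ∈ S then (2 : ℝ) else 1) (fun S => ?_)
    fun G hG => ?_).trans (ENNReal.ofReal_le_ofReal ?_)
  · refine mul_nonneg (Real.exp_pos _).le (Finset.prod_nonneg fun e _ => ?_)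
    split_ifs <;> norm_num
  · rw [prod_ite_mem]
    simp only [mem_edgeFinset]
    rw [Real.exp_neg, ← div_eq_inv_mul, one_le_div (Real.exp_pos _)]
    calc Real.exp (m / 2) = (Real.exp (1 / 2)) ^ m := by rw [← Real.exp_nat_mul]; congr 1; ring
      _ ≤ 2 ^ m := by
          refine pow_le_pow_left₀ (Real.exp_pos _).le ?_ _
          rw [← Real.le_log_iff_exp_le (by norm_num)]
          linarith [Real.log_two_gt_d9]
      _ ≤ _ := pow_le_pow_right₀ (by norm_num) hG
  · rw [expect_const_mul, expect_prod_ite hF, sub_eq_neg_add _ ((m : ℝ) / 2), Real.exp_add]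
    refine mul_le_mul_of_nonneg_left ?_ (Real.exp_pos _).le
    calc (1 - (p : ℝ) + p * 2) ^ F.card ≤ (Real.exp p) ^ F.card := by
          refine pow_le_pow_left₀ (by linarith [p.2.1]) ?_ _
          linarith [Real.add_one_le_exp (p : ℝ)]
      _ = _ := by rw [← Real.exp_nat_mul]; congr 1; ring

/-- Lower tail for the number of vertices in `X` with neighbours in both `A` and `A'`. -/
lemma binomialRandom_common_le {X A A' : Finset V} (hA : Disjoint X A) (hA' : Disjoint X A')
    (hAA : Disjoint A A') (hcard : A'.card = A.card) (m : ℕ) :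
    binomialRandom V p {G | (X.filter fun x => (∃ y ∈ A, G.Adj x y) ∧
      ∃ y ∈ A', G.Adj x y).card ≤ m} ≤
      ENNReal.ofReal (Real.exp (m - X.card * (p * A.card / (1 + p * A.card)) ^ 2 / 2)) := by
  set F : Finset V → V → Finset (Sym2 V) := fun A x => A.image fun y => s(x, y) with hF
  have hFE : ∀ A : Finset V, Disjoint X A → ∀ x ∈ X, F A x ⊆ (⊤ : SimpleGraph V).edgeFinset := by
    intro A hA x hx e he
    obtain ⟨y, hy, rfl⟩ := Finset.mem_image.1 he
    rw [mem_edgeFinset, mem_edgeSet, top_adj]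
    exact fun h => Finset.disjoint_left.1 hA hx (h ▸ hy)
  have hFc : ∀ (A : Finset V) (x : V), (F A x).card = A.card := fun A x =>
    Finset.card_image_of_injective _ fun y y' h => Sym2.congr_right.1 h
  have hex : ∀ (A : Finset V) (x : V) (G : SimpleGraph V),
      (∃ e ∈ F A x, e ∈ G.edgeFinset) ↔ ∃ y ∈ A, G.Adj x y := by
    intro A x G
    simp [F]
  refine (binomialRandom_le_expect _ (fun S => Real.exp m * ∏ x ∈ X,
    if (∃ e ∈ F A x, e ∈ S) ∧ ∃ e ∈ F A' x, e ∈ S then (1 / 2 : ℝ) else 1) (fun S => ?_)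
    fun G hG => ?_).trans (ENNReal.ofReal_le_ofReal ?_)
  · refine mul_nonneg (Real.exp_pos _).le (Finset.prod_nonneg fun e _ => ?_)
    split_ifs <;> norm_num
  · rw [Finset.prod_ite, Finset.prod_const, Finset.prod_const_one, mul_one]
    simp only [hex]
    exact one_le_exp_mul_half_pow hG le_rfl
  · rw [expect_const_mul, sub_eq_add_neg, Real.exp_add]
    refine mul_le_mul_of_nonneg_left ?_ (Real.exp_pos _).le
    refine expect_prod_both_le p.2.1 p.2.2 X (F A) (F A') A.card (hFE A hA) (hFE A' hA')
      (fun x _ => hFc A x) (fun x _ => (hFc A' x).trans hcard) (fun x hx => ?_) ?_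
    · refine Finset.disjoint_left.2 fun e he he' => ?_
      obtain ⟨y, hy, rfl⟩ := Finset.mem_image.1 he
      obtain ⟨y', hy', h⟩ := Finset.mem_image.1 he'
      rw [Sym2.congr_right.1 h] at hy'
      exact Finset.disjoint_left.1 hAA hy hy'
    · intro x hx x' hx' hxx
      refine Finset.disjoint_left.2 fun e he he' => hxx ?_
      have hU : ∀ x, F A x ∪ F A' x = F (A ∪ A') x := fun x => (Finset.image_union _ _).symm
      simp only [hU] at he he'
      obtain ⟨y, hy, rfl⟩ := Finset.mem_image.1 he
      obtain ⟨y', hy', h⟩ := Finset.mem_image.1 he'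
      rcases Sym2.eq_iff.1 h with ⟨h1, -⟩ | ⟨h1, -⟩
      · exact h1.symm
      · have hd : Disjoint X (A ∪ A') := Finset.disjoint_union_right.2 ⟨hA, hA'⟩
        exact absurd (h1 ▸ hy) (Finset.disjoint_left.1 hd hx')

end RandomGraph

/-! ### Pseudorandomness of the binomial random graph -/

section UnionBounds

open MeasureTheory unitInterval SimpleGraph

variable {V : Type*} {p : I}

lemma binomialRandom_exists_le {ι : Type*} (S : Finset ι) (P : ι → SimpleGraph V → Prop) {x y : ℝ}
    (hS : (S.card : ℝ) ≤ Real.exp x)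
    (hP : ∀ i ∈ S, binomialRandom V p {G | P i G} ≤ ENNReal.ofReal (Real.exp y)) :
    binomialRandom V p {G | ∃ i ∈ S, P i G} ≤ ENNReal.ofReal (Real.exp (x + y)) := by
  calc binomialRandom V p {G | ∃ i ∈ S, P i G}
      ≤ binomialRandom V p (⋃ i ∈ S, {G | P i G}) := measure_mono fun G hG => by simpa using hG
    _ ≤ ∑ i ∈ S, binomialRandom V p {G | P i G} := measure_biUnion_finset_le _ _
    _ ≤ ∑ _i ∈ S, ENNReal.ofReal (Real.exp y) := Finset.sum_le_sum hP
    _ = ENNReal.ofReal (S.card * Real.exp y) := by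
        rw [Finset.sum_const, nsmul_eq_mul, ENNReal.ofReal_mul (by positivity),
          ENNReal.ofReal_natCast]
    _ ≤ ENNReal.ofReal (Real.exp (x + y)) := by
        rw [Real.exp_add]
        exact ENNReal.ofReal_le_ofReal (mul_le_mul_of_nonneg_right hS (Real.exp_pos _).le)

lemma binomialRandom_le_of_forall_not {P : SimpleGraph V → Prop} (h : ∀ G, ¬ P G) {b : ENNReal} :
    binomialRandom V p {G | P G} ≤ b := by
  simp [h]

variable [Fintype V] [Nonempty V]

lemma cast_card_pow_eq_exp (k : ℕ) :
    ((Fintype.card V : ℝ)) ^ k = Real.exp (k * Real.log (Fintype.card V)) := by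
  rw [Real.exp_nat_mul, Real.exp_log (by exact_mod_cast Fintype.card_pos)]

lemma card_powersetCard_le_exp (k : ℕ) :
    (((Finset.univ : Finset V).powersetCard k).card : ℝ) ≤
      Real.exp (k * Real.log (Fintype.card V)) := by
  rw [← cast_card_pow_eq_exp, Finset.card_powersetCard, Finset.card_univ]
  exact_mod_cast Nat.choose_le_pow _ _

variable [DecidableEq V]

lemma binomialRandom_not_degree_le {cls : V → ℕ} {q d c : ℕ} (hqn : q ≤ Fintype.card V)
    (hc : ∀ o < q, c + 1 ≤ (Finset.univ.filter fun x => cls x = o).card)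
    (h : d + 3 * Real.log (Fintype.card V) ≤ p * c / 2) :
    binomialRandom V p {G | ¬ ∀ v, ∀ o < q,
      d ≤ (Finset.univ.filter fun x => G.Adj v x ∧ cls x = o).card} ≤
      ENNReal.ofReal (Real.exp (-Real.log (Fintype.card V))) := by
  set L := Real.log (Fintype.card V) with hL
  refine le_trans (measure_mono (fun G hG => ?_)) ((binomialRandom_exists_le (V := V)
    (Finset.univ ×ˢ Finset.range q) (fun z G =>
      (Finset.univ.filter fun x => G.Adj z.1 x ∧ cls x = z.2).card ≤ d)
    (x := 2 * L) (y := d - p * c / 2) ?_ ?_).trans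
      (ENNReal.ofReal_le_ofReal (Real.exp_le_exp.2 (by linarith))))
  · simp only [Set.mem_ofPred_eq, not_forall, not_le] at hG
    obtain ⟨v, o, ho, hlt⟩ := hG
    exact ⟨(v, o), by simp [ho], hlt.le⟩
  · have := cast_card_pow_eq_exp (V := V) 2
    rw [Nat.cast_ofNat, ← hL] at this
    rw [← this, Finset.card_product, Finset.card_range, Finset.card_univ, pow_two]
    exact_mod_cast Nat.mul_le_mul_left _ hqn
  · rintro ⟨v, o⟩ hz
    have ho : o < q := by simpa using hz
    set X := (Finset.univ.filter fun x => cls x = o).erase v with hX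
    have hXc : c ≤ X.card := by
      have h1 : (Finset.univ.filter fun x => cls x = o).card - 1 ≤ X.card :=
        Finset.pred_card_le_card_erase
      have h2 := hc o ho
      omega
    set F := X.image fun x => s(v, x) with hF
    have hFc : F.card = X.card :=
      Finset.card_image_of_injective _ fun y y' h => Sym2.congr_right.1 h
    have hFE : F ⊆ (⊤ : SimpleGraph V).edgeFinset := by
      intro e he
      obtain ⟨x, hx, rfl⟩ := Finset.mem_image.1 he
      rw [mem_edgeFinset, mem_edgeSet, top_adj]
      exact fun h => (Finset.mem_erase.1 hx).1 h.symm
    refine le_trans (measure_mono (fun G hG => ?_)) ((binomialRandom_card_le (p := p) hFE d).trans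
      (ENNReal.ofReal_le_ofReal (Real.exp_le_exp.2 ?_)))
    · refine le_trans (b := (Finset.univ.filter fun x => G.Adj v x ∧ cls x = o).card) ?_ hG
      have : F.filter (· ∈ G.edgeSet) ⊆
          (Finset.univ.filter fun x => G.Adj v x ∧ cls x = o).image fun x => s(v, x) := by
        intro e he
        obtain ⟨he, heG⟩ := Finset.mem_filter.1 he
        obtain ⟨x, hx, rfl⟩ := Finset.mem_image.1 he
        refine Finset.mem_image.2 ⟨x, ?_, rfl⟩
        have hx := (Finset.mem_filter.1 (Finset.mem_erase.1 hx).2).2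
        simpa [hx] using heG
      exact (Finset.card_le_card this).trans Finset.card_image_le
    · have h1 : (c : ℝ) ≤ F.card := by rw [hFc]; exact_mod_cast hXc
      have := mul_le_mul_of_nonneg_left h1 p.2.1
      linarith

/-- The union bound for common neighbourhoods is carried out for each label and each size `a` of
the two sets separately, since the tail bound depends on `a`. -/
lemma binomialRandom_not_common_le {cls : V → ℕ} {q a₀ M D c : ℕ} (hqn : q ≤ Fintype.card V)
    (hMn : M < Fintype.card V)
    (hc : ∀ o < q, c ≤ (Finset.univ.filter fun x => cls x = o).card)
    (h : ∀ a : ℕ, a₀ ≤ a → a ≤ M → 4 * D * a + (2 * a + 3) * Real.log (Fintype.card V) ≤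
      c * (p * a / (1 + p * a)) ^ 2 / 2) :
    binomialRandom V p {G | ¬ ∀ o < q, ∀ A A' : Finset V, Disjoint A A' → (∀ x ∈ A, cls x ≠ o) →
      (∀ x ∈ A', cls x ≠ o) → A'.card = A.card → a₀ ≤ A.card → A.card ≤ M →
      4 * D * A.card ≤ (Finset.univ.filter fun x => cls x = o ∧ (∃ y ∈ A, G.Adj x y) ∧
        ∃ y ∈ A', G.Adj x y).card} ≤
      ENNReal.ofReal (Real.exp (-Real.log (Fintype.card V))) := by
  set L := Real.log (Fintype.card V) with hL
  refine le_trans (measure_mono (fun G hG => ?_)) (binomialRandom_exists_le (V := V)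
    (Finset.range q ×ˢ Finset.range (Fintype.card V)) (fun z G => z.1 < q ∧ a₀ ≤ z.2 ∧ z.2 ≤ M ∧
      ∃ w ∈ (Finset.univ : Finset V).powersetCard z.2 ×ˢ Finset.univ.powersetCard z.2,
      Disjoint w.1 w.2 ∧ (∀ x ∈ w.1, cls x ≠ z.1) ∧ (∀ x ∈ w.2, cls x ≠ z.1) ∧
      ((Finset.univ.filter fun x => cls x = z.1).filter fun x => (∃ y ∈ w.1, G.Adj x y) ∧
        ∃ y ∈ w.2, G.Adj x y).card ≤ 4 * D * z.2)
    (x := 2 * L) (y := -(3 * L)) ?_ ?_ |>.trans_eq (by congr 2; ring))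
  · simp only [Set.mem_ofPred_eq, not_forall, not_le] at hG
    obtain ⟨o, ho, A, A', hAA, hA, hA', hcard, h₁, h₂, hlt⟩ := hG
    refine ⟨(o, A.card), by simp [ho]; omega, ho, h₁, h₂, (A, A'), ?_, hAA, hA, hA', ?_⟩
    · simp [Finset.mem_powersetCard, hcard]
    · rw [Finset.filter_filter]
      exact hlt.le
  · have := cast_card_pow_eq_exp (V := V) 2
    rw [Nat.cast_ofNat, ← hL] at this
    rw [← this, Finset.card_product, Finset.card_range, Finset.card_range, pow_two]
    exact_mod_cast Nat.mul_le_mul_right _ hqn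
  · rintro ⟨o, a⟩ -
    by_cases hoa : o < q ∧ a₀ ≤ a ∧ a ≤ M
    swap
    · exact binomialRandom_le_of_forall_not fun G hG => hoa ⟨hG.1, hG.2.1, hG.2.2.1⟩
    obtain ⟨ho, h₁, h₂⟩ := hoa
    refine le_trans (measure_mono (fun G hG => hG.2.2.2)) (binomialRandom_exists_le (V := V)
      _ _ (x := 2 * (a * L)) (y := -((2 * a + 3) * L)) ?_ ?_ |>.trans_eq (by congr 2; ring))
    · have := card_powersetCard_le_exp (V := V) a
      rw [Finset.card_product, two_mul, Real.exp_add, Nat.cast_mul]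
      exact mul_le_mul this this (by positivity) (Real.exp_pos _).le
    · rintro ⟨A, A'⟩ hw
      simp only [Finset.mem_product, Finset.mem_powersetCard, Finset.subset_univ, true_and] at hw
      by_cases hd : Disjoint A A' ∧ (∀ x ∈ A, cls x ≠ o) ∧ ∀ x ∈ A', cls x ≠ o
      swap
      · exact binomialRandom_le_of_forall_not fun G hG => hd ⟨hG.1, hG.2.1, hG.2.2.1⟩
      obtain ⟨hAA, hA, hA'⟩ := hd
      refine le_trans (measure_mono (fun G hG => hG.2.2.2)) ((binomialRandom_common_le (p := p)
        (X := Finset.univ.filter fun x => cls x = o) (A := A) (A' := A')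
        (Finset.disjoint_right.2 fun x hx => by simp [hA x hx])
        (Finset.disjoint_right.2 fun x hx => by simp [hA' x hx]) hAA
        (hw.2.trans hw.1.symm) (4 * D * a)).trans
        (ENNReal.ofReal_le_ofReal (Real.exp_le_exp.2 ?_)))
      have h3 := h a h₁ h₂
      have h4 : (c : ℝ) ≤ (Finset.univ.filter fun x => cls x = o).card := by
        exact_mod_cast hc o ho
      have h5 := mul_le_mul_of_nonneg_right h4 (sq_nonneg ((p : ℝ) * a / (1 + p * a)))
      rw [hw.1]
      push_cast
      linarith

lemma binomialRandom_not_cross_le {M D : ℕ} (hM : 1 ≤ M)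
    (h : D + 3 * Real.log (Fintype.card V) ≤ p * M / 2) :
    binomialRandom V p {G | ¬ ∀ A S : Finset V, Disjoint S A → A.card = M → S.card = M →
      D * M < ((S ×ˢ A).filter fun z => G.Adj z.1 z.2).card} ≤
      ENNReal.ofReal (Real.exp (-Real.log (Fintype.card V))) := by
  set L := Real.log (Fintype.card V) with hL
  have hL0 : 0 ≤ L := Real.log_natCast_nonneg _
  have hM' : (1 : ℝ) ≤ M := by exact_mod_cast hM
  refine le_trans (measure_mono (fun G hG => ?_)) (binomialRandom_exists_le (V := V)
    ((Finset.univ : Finset V).powersetCard M ×ˢ Finset.univ.powersetCard M) (fun w G =>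
      Disjoint w.2 w.1 ∧ ((w.2 ×ˢ w.1).filter fun z => G.Adj z.1 z.2).card ≤ D * M)
    (x := 2 * (M * L)) (y := D * M - p * (M * M) / 2) ?_ ?_ |>.trans
      (ENNReal.ofReal_le_ofReal (Real.exp_le_exp.2 ?_)))
  · simp only [Set.mem_ofPred_eq, not_forall, not_lt] at hG
    obtain ⟨A, S, hSA, hA, hS, hle⟩ := hG
    exact ⟨(A, S), by simp [Finset.mem_powersetCard, hA, hS], hSA, hle⟩
  · have := card_powersetCard_le_exp (V := V) M
    rw [Finset.card_product, two_mul, Real.exp_add, Nat.cast_mul]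
    exact mul_le_mul this this (by positivity) (Real.exp_pos _).le
  · rintro ⟨A, S⟩ hw
    simp only [Finset.mem_product, Finset.mem_powersetCard, Finset.subset_univ, true_and] at hw
    by_cases hd : Disjoint S A
    swap
    · exact binomialRandom_le_of_forall_not fun G hG => hd hG.1
    set F := (S ×ˢ A).image fun z => s(z.1, z.2) with hF
    have hinj : Set.InjOn (fun z : V × V => s(z.1, z.2)) (S ×ˢ A : Finset (V × V)) := by
      rintro ⟨x, y⟩ hz ⟨x', y'⟩ hz' heq
      simp only [Finset.coe_product, Set.mem_prod, Finset.mem_coe] at hz hz'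
      rcases Sym2.eq_iff.1 heq with ⟨rfl, rfl⟩ | ⟨rfl, rfl⟩
      · rfl
      · exact absurd hz'.2 (Finset.disjoint_left.1 hd hz.1)
    have hFc : F.card = M * M := by
      rw [hF, Finset.card_image_of_injOn hinj, Finset.card_product, hw.1, hw.2]
    have hFE : F ⊆ (⊤ : SimpleGraph V).edgeFinset := by
      intro e he
      obtain ⟨⟨x, y⟩, hz, rfl⟩ := Finset.mem_image.1 he
      simp only [Finset.mem_product] at hz
      rw [mem_edgeFinset, mem_edgeSet, top_adj]
      exact fun h => Finset.disjoint_left.1 hd hz.1 ((show x = y from h) ▸ hz.2)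
    refine le_trans (measure_mono (fun G hG => ?_))
      ((binomialRandom_card_le (p := p) hFE (D * M)).trans (le_of_eq ?_))
    · refine le_trans (Finset.card_le_card ?_)
        ((Finset.card_image_le (f := fun z : V × V => s(z.1, z.2))).trans hG.2)
      intro e he
      obtain ⟨he, heG⟩ := Finset.mem_filter.1 he
      obtain ⟨z, hz, rfl⟩ := Finset.mem_image.1 he
      exact Finset.mem_image.2 ⟨z, Finset.mem_filter.2 ⟨hz, heG⟩, rfl⟩
    · rw [hFc]
      push_cast
      rfl
  · have h1 := mul_le_mul_of_nonneg_right h (by positivity : (0 : ℝ) ≤ M)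
    have h2 : L ≤ M * L := le_mul_of_one_le_left hL0 hM'
    nlinarith

/-- If `R` vertices had `d₂` neighbours each in a set of `3 M` vertices, then at least `R d₂ / 2`
edges would run between these vertices and the set. -/
lemma binomialRandom_not_concentrated_le {M R d₂ : ℕ} (hMn : 3 * M ≤ Fintype.card V)
    (h : 3 * (p : ℝ) * M * R + (3 * M + R + 1) * Real.log (Fintype.card V) + 1 ≤ R * d₂ / 4) :
    binomialRandom V p {G | ¬ ∀ U : Finset V, U.card ≤ 3 * M →
      (Finset.univ.filter fun x => d₂ ≤ (U.filter fun y => G.Adj x y).card).card < R} ≤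
      ENNReal.ofReal (Real.exp (-Real.log (Fintype.card V))) := by
  set L := Real.log (Fintype.card V) with hL
  set m : ℕ := R * d₂ / 2 with hm
  have hmr : (R * d₂ : ℝ) / 2 - 1 ≤ m := by
    have : R * d₂ ≤ 2 * m + 1 := by omega
    have : (R * d₂ : ℝ) ≤ 2 * m + 1 := by exact_mod_cast this
    linarith
  refine le_trans (measure_mono (fun G hG => ?_)) (binomialRandom_exists_le (V := V)
    ((Finset.univ : Finset V).powersetCard (3 * M) ×ˢ Finset.univ.powersetCard R) (fun w G =>
      R * d₂ ≤ ((w.2 ×ˢ w.1).filter fun z => G.Adj z.1 z.2).card)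
    (x := (3 * M + R) * L) (y := p * (R * (3 * M)) - m / 2) ?_ ?_ |>.trans
      (ENNReal.ofReal_le_ofReal (Real.exp_le_exp.2 ?_)))
  · simp only [Set.mem_ofPred_eq, not_forall, not_lt] at hG
    obtain ⟨U, hU, hle⟩ := hG
    obtain ⟨U', hUU', hU'⟩ := Finset.exists_superset_card_eq hU hMn
    obtain ⟨S, hSsub, hS⟩ := Finset.exists_subset_card_eq hle
    refine ⟨(U', S), by simp [Finset.mem_powersetCard, hU', hS], ?_⟩
    have e1 : ((S ×ˢ U').filter fun z => G.Adj z.1 z.2).card =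
        ∑ x ∈ S, (U'.filter fun y => G.Adj x y).card := by
      simp only [Finset.card_filter]
      rw [Finset.sum_product]
    simp only
    rw [e1, ← hS, ← smul_eq_mul]
    refine Finset.card_nsmul_le_sum _ _ _ fun x hx => ?_
    exact (Finset.mem_filter.1 (hSsub hx)).2.trans
      (Finset.card_le_card (Finset.filter_subset_filter _ hUU'))
  · have h1 := card_powersetCard_le_exp (V := V) (3 * M)
    have h2 := card_powersetCard_le_exp (V := V) R
    rw [Finset.card_product, add_mul, Real.exp_add, Nat.cast_mul]
    push_cast at h1
    exact mul_le_mul h1 h2 (by positivity) (Real.exp_pos _).le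
  · rintro ⟨U, S⟩ hw
    simp only [Finset.mem_product, Finset.mem_powersetCard, Finset.subset_univ, true_and] at hw
    set F := ((S ×ˢ U).filter fun z => z.1 ≠ z.2).image fun z => s(z.1, z.2) with hF
    have hFc : F.card ≤ R * (3 * M) := by
      rw [← hw.1, ← hw.2, ← Finset.card_product]
      exact Finset.card_image_le.trans (Finset.card_filter_le _ _)
    have hFE : F ⊆ (⊤ : SimpleGraph V).edgeFinset := by
      intro e he
      obtain ⟨⟨x, y⟩, hz, rfl⟩ := Finset.mem_image.1 he
      rw [mem_edgeFinset, mem_edgeSet, top_adj]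
      exact (Finset.mem_filter.1 hz).2
    refine le_trans (measure_mono (fun G hG => ?_))
      ((binomialRandom_le_card (p := p) hFE m).trans
        (ENNReal.ofReal_le_ofReal (Real.exp_le_exp.2 ?_)))
    · -- Every edge arises from at most two pairs.
      have hle : ((S ×ˢ U).filter fun z => G.Adj z.1 z.2).card ≤
          2 * (F.filter (· ∈ G.edgeSet)).card := by
        refine Finset.card_le_mul_card_image_of_maps_to (f := fun z : V × V => s(z.1, z.2)) ?_ 2 ?_
        · rintro ⟨x, y⟩ hz
          obtain ⟨hz, hxy⟩ := Finset.mem_filter.1 hz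
          refine Finset.mem_filter.2 ⟨Finset.mem_image.2 ⟨(x, y), ?_, rfl⟩, hxy⟩
          exact Finset.mem_filter.2 ⟨hz, hxy.ne⟩
        · intro e _
          induction e with
          | _ a b =>
          refine (Finset.card_le_card (t := {(a, b), (b, a)}) fun z hz => ?_).trans
            Finset.card_le_two
          have := (Finset.mem_filter.1 hz).2
          rcases Sym2.eq_iff.1 this with ⟨h1, h2⟩ | ⟨h1, h2⟩
          · exact Finset.mem_insert.2 (Or.inl (Prod.ext h1 h2))
          · exact Finset.mem_insert.2 (Or.inr (Finset.mem_singleton.2 (Prod.ext h1 h2)))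
      have hG' : R * d₂ ≤ ((S ×ˢ U).filter fun z => G.Adj z.1 z.2).card := hG
      show m ≤ _
      omega
    · have h1 : (F.card : ℝ) ≤ R * (3 * M) := by exact_mod_cast hFc
      have := mul_le_mul_of_nonneg_left h1 p.2.1
      linarith
  · nlinarith

/-- The random graph is pseudorandom with probability at least `1 - 4 / n` if the parameters are
suitable. -/
lemma binomialRandom_not_pseudorandom_le {cls : V → ℕ} {q d d₂ a₀ M R D c : ℕ}
    (hqn : q ≤ Fintype.card V) (hM : 1 ≤ M) (hMn : 3 * M ≤ Fintype.card V)
    (hc : ∀ o < q, c + 1 ≤ (Finset.univ.filter fun x => cls x = o).card) (hMc : 4 * M ≤ c)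
    (h₁ : d + 3 * Real.log (Fintype.card V) ≤ p * c / 2)
    (h₂ : ∀ a : ℕ, a₀ ≤ a → a ≤ M → 4 * D * a + (2 * a + 3) * Real.log (Fintype.card V) ≤
      c * (p * a / (1 + p * a)) ^ 2 / 2)
    (h₃ : D + 3 * Real.log (Fintype.card V) ≤ p * M / 2)
    (h₄ : 3 * (p : ℝ) * M * R + (3 * M + R + 1) * Real.log (Fintype.card V) + 1 ≤ R * d₂ / 4) :
    binomialRandom V p {G | ¬ Pseudorandom G cls q d d₂ a₀ M R D} ≤
      4 * ENNReal.ofReal (Real.exp (-Real.log (Fintype.card V))) := by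
  set b := ENNReal.ofReal (Real.exp (-Real.log (Fintype.card V))) with hb
  set E₁ := {G : SimpleGraph V | ¬ ∀ v, ∀ o < q,
      d ≤ (Finset.univ.filter fun x => G.Adj v x ∧ cls x = o).card} with hE₁
  set E₂ := {G : SimpleGraph V | ¬ ∀ o < q, ∀ A A' : Finset V, Disjoint A A' →
      (∀ x ∈ A, cls x ≠ o) → (∀ x ∈ A', cls x ≠ o) → A'.card = A.card → a₀ ≤ A.card → A.card ≤ M →
      4 * D * A.card ≤ (Finset.univ.filter fun x => cls x = o ∧ (∃ y ∈ A, G.Adj x y) ∧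
        ∃ y ∈ A', G.Adj x y).card} with hE₂
  set E₃ := {G : SimpleGraph V | ¬ ∀ A S : Finset V, Disjoint S A → A.card = M → S.card = M →
      D * M < ((S ×ˢ A).filter fun z => G.Adj z.1 z.2).card} with hE₃
  set E₄ := {G : SimpleGraph V | ¬ ∀ U : Finset V, U.card ≤ 3 * M →
      (Finset.univ.filter fun x => d₂ ≤ (U.filter fun y => G.Adj x y).card).card < R} with hE₄
  have b₁ : binomialRandom V p E₁ ≤ b := binomialRandom_not_degree_le hqn hc h₁
  have b₂ : binomialRandom V p E₂ ≤ b :=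
    binomialRandom_not_common_le hqn (by omega) (fun o ho => by have := hc o ho; omega) h₂
  have b₃ : binomialRandom V p E₃ ≤ b := binomialRandom_not_cross_le hM h₃
  have b₄ : binomialRandom V p E₄ ≤ b := binomialRandom_not_concentrated_le hMn h₄
  have hsub : {G | ¬ Pseudorandom G cls q d d₂ a₀ M R D} ⊆ ((E₁ ∪ E₂) ∪ E₃) ∪ E₄ := by
    intro G hG
    by_contra hcon
    simp only [Set.mem_union, not_or, hE₁, hE₂, hE₃, hE₄, Set.mem_ofPred_eq, not_not] at hcon
    exact hG ⟨hcon.1.1.1, hcon.1.1.2, hcon.1.2, hcon.2, fun o ho => by have := hc o ho; omega⟩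
  calc binomialRandom V p {G | ¬ Pseudorandom G cls q d d₂ a₀ M R D}
      ≤ binomialRandom V p (((E₁ ∪ E₂) ∪ E₃) ∪ E₄) := measure_mono hsub
    _ ≤ binomialRandom V p ((E₁ ∪ E₂) ∪ E₃) + binomialRandom V p E₄ := measure_union_le _ _
    _ ≤ binomialRandom V p (E₁ ∪ E₂) + binomialRandom V p E₃ + binomialRandom V p E₄ := by
        gcongr; exact measure_union_le _ _
    _ ≤ binomialRandom V p E₁ + binomialRandom V p E₂ + binomialRandom V p E₃ +
          binomialRandom V p E₄ := by
        gcongr; exact measure_union_le _ _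
    _ ≤ b + b + b + b := by gcongr
    _ = 4 * b := by ring

end UnionBounds

end ConnectorBreaker

namespace ConnectorBreaker

/-! ### Choice of the parameters -/

section Parameters

open unitInterval

lemma le_card_filter_mod_eq {n q o : ℕ} (ho : o < q) :
    n / q ≤ (Finset.univ.filter fun x : Fin n => (x : ℕ) % q = o).card := by
  have hlt : ∀ i < n / q, q * i + o < n := by
    intro i hi
    have h1 : q * (i + 1) ≤ q * (n / q) := Nat.mul_le_mul_left _ hi
    have h2 := Nat.mul_div_le n q
    rw [Nat.mul_succ] at h1
    omega
  calc n / q = (Finset.univ : Finset (Fin (n / q))).card := by simp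
    _ ≤ _ := by
      refine Finset.card_le_card_of_injOn
        (fun i : Fin (n / q) => (⟨q * i + o, hlt i i.2⟩ : Fin n)) ?_ ?_
      · intro i _
        simp [Nat.mod_eq_of_lt ho]
      · intro i _ i' _ h
        have h1 : q * (i : ℕ) + o = q * (i' : ℕ) + o := congrArg Fin.val h
        exact Fin.ext (Nat.eq_of_mul_eq_mul_left (by omega) (Nat.add_right_cancel h1))

/-- The numerical condition for common neighbourhoods. Here `c` is the size of a label class, `D`
bounds the Breaker degrees, and the sizes `a` of the two sets range from `min M d` to `M`. -/
lemma common_condition {N P Q s L D M d c a : ℝ} (hs : 2 ^ 24 * Q ≤ s) (hQ : 1 ≤ Q) (hN : 0 < N)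
    (hP : 0 < P) (hL : 0 ≤ L) (hsL : 5 * L ≤ s) (h₁ : s ^ 5 ≤ N * P) (h₂ : s ^ 9 ≤ N ^ 2 * P ^ 3)
    (hD : D ≤ s) (hMlow : s ^ 3 ≤ P * M) (hMup : P * M ≤ 2 * s ^ 3)
    (hc : N / (2 * Q) ≤ c) (hd : N * P / (128 * Q) ≤ d) (ha1 : 1 ≤ a) (had : min M d ≤ a)
    (haM : a ≤ M) : 4 * D * a + (2 * a + 3) * L ≤ c * (P * a / (1 + P * a)) ^ 2 / 2 := by
  have hs1 : 1 ≤ s := by linarith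
  have hs0 : 0 < s := by linarith
  have hlhs : 4 * D * a + (2 * a + 3) * L ≤ 5 * s * a := by
    have h1 : 4 * D * a ≤ 4 * s * a := by gcongr
    have h2 : (2 * a + 3) * L ≤ 5 * a * L := by gcongr; linarith
    have h3 : 5 * L * a ≤ s * a := by gcongr
    linarith
  have hPa : 1 + P * a ≤ 3 * s ^ 3 := by
    have h1 : P * a ≤ P * M := by gcongr
    have h2 : 1 ≤ s ^ 3 := one_le_pow₀ hs1
    linarith
  have hy : P * a / (3 * s ^ 3) ≤ P * a / (1 + P * a) := by gcongr
  have hs78 : 180 * Q * s ^ 7 ≤ s ^ 8 := by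
    calc 180 * Q * s ^ 7 ≤ s * s ^ 7 := by gcongr; linarith
      _ = s ^ 8 := by ring
  -- The sets grow because `N P² a` is large, both for `a = M ≈ s³ / P` and for `a = d ≈ N P`.
  have hkey : 180 * Q * s ^ 7 ≤ N * P ^ 2 * a := by
    refine le_trans ?_ (mul_le_mul_of_nonneg_left had (by positivity : 0 ≤ N * P ^ 2))
    rcases min_choice M d with hmin | hmin
    · rw [hmin]
      calc 180 * Q * s ^ 7 ≤ s ^ 8 := hs78
        _ = s ^ 5 * s ^ 3 := by ring
        _ ≤ N * P * (P * M) := by gcongr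
        _ = N * P ^ 2 * M := by ring
    · rw [hmin]
      have h1 : 128 * Q * (180 * Q * s ^ 7) ≤ N ^ 2 * P ^ 3 := by
        calc 128 * Q * (180 * Q * s ^ 7) ≤ s * s ^ 8 := by
              refine mul_le_mul ?_ hs78 (by positivity) hs0.le
              linarith
          _ = s ^ 9 := by ring
          _ ≤ N ^ 2 * P ^ 3 := h₂
      calc 180 * Q * s ^ 7 ≤ N ^ 2 * P ^ 3 / (128 * Q) := by
            rw [le_div_iff₀ (by positivity)]
            linarith
        _ = N * P ^ 2 * (N * P / (128 * Q)) := by ring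
        _ ≤ N * P ^ 2 * d := by gcongr
  have hQ0 : 0 < Q := by linarith
  have hc0 : 0 ≤ c := le_trans (by positivity) hc
  calc 4 * D * a + (2 * a + 3) * L ≤ 5 * s * a := hlhs
    _ ≤ N / (2 * Q) * (P * a / (3 * s ^ 3)) ^ 2 / 2 := by
        have h1 : N / (2 * Q) * (P * a / (3 * s ^ 3)) ^ 2 / 2 =
            (N * P ^ 2 * a) * a / (36 * Q * s ^ 6) := by field_simp; norm_num
        rw [h1, le_div_iff₀ (by positivity)]
        calc 5 * s * a * (36 * Q * s ^ 6) = 180 * Q * s ^ 7 * a := by ring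
          _ ≤ N * P ^ 2 * a * a := by gcongr
    _ ≤ c * (P * a / (1 + P * a)) ^ 2 / 2 := by gcongr

/-- The numerical condition for the concentration of neighbourhoods. -/
lemma concentrated_condition {N P Q s L M d R : ℝ} (hs : 2 ^ 24 * Q ≤ s) (hQ : 1 ≤ Q) (hN : 0 < N)
    (hP : 0 < P) (hL : 0 ≤ L) (hsL : 5 * (1 + L) ≤ s) (h₁ : s ^ 5 ≤ N * P)
    (h₂ : s ^ 9 ≤ N ^ 2 * P ^ 3) (hMup : P * M ≤ 2 * s ^ 3)
    (hd : N * P / (128 * Q) ≤ d) (hR : N * P / (1024 * Q) ≤ R) (hR1 : 1 ≤ R) :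
    3 * P * M * R + (3 * M + R + 1) * L + 1 ≤ R * d / 4 := by
  have hs1 : 1 ≤ s := by linarith
  have hs0 : 0 < s := by linarith
  have hs13 : s ≤ s ^ 3 := le_self_pow₀ hs1 (by norm_num)
  set Y := N * P / (1024 * Q) with hY
  have t₁ : 3 * P * M * R ≤ 6 * s ^ 3 * R := by
    calc 3 * P * M * R = 3 * R * (P * M) := by ring
      _ ≤ 3 * R * (2 * s ^ 3) := by gcongr
      _ = 6 * s ^ 3 * R := by ring
  have t₂ : R * L + L + 1 ≤ s ^ 3 * R := by
    have h2 : s * R ≤ s ^ 3 * R := by gcongr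
    have h3 : R * L ≤ R * (s / 5) := by gcongr; linarith
    have h4 : s * 1 ≤ s * R := by gcongr
    linarith
  have t₃ : 7 * s ^ 3 * R ≤ R * Y := by
    have h2 : 7 * s ^ 3 ≤ Y := by
      rw [hY, le_div_iff₀ (by positivity)]
      calc 7 * s ^ 3 * (1024 * Q) = 7168 * Q * s ^ 3 := by ring
        _ ≤ s ^ 2 * s ^ 3 := by
            gcongr
            calc 7168 * Q ≤ s := by linarith
              _ ≤ s ^ 2 := le_self_pow₀ hs1 (by norm_num)
        _ = s ^ 5 := by ring
        _ ≤ N * P := h₁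
    calc 7 * s ^ 3 * R ≤ Y * R := by gcongr
      _ = _ := mul_comm _ _
  have t₄ : 3 * M * L ≤ R * Y := by
    have h1 : P * (3 * M * L) ≤ P * (R * Y) := by
      calc P * (3 * M * L) = 3 * L * (P * M) := by ring
        _ ≤ 3 * L * (2 * s ^ 3) := by gcongr
        _ ≤ 3 * s * (2 * s ^ 3) := by gcongr; linarith
        _ = 6 * s ^ 4 := by ring
        _ ≤ N ^ 2 * P ^ 3 / (1024 * Q) ^ 2 := by
            rw [le_div_iff₀ (by positivity)]
            have h3 : 6 * (1024 * Q) ^ 2 ≤ s ^ 2 := by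
              calc 6 * (1024 * Q) ^ 2 ≤ (2 ^ 24 * Q) ^ 2 := by
                    rw [mul_pow, mul_pow, ← mul_assoc]
                    gcongr
                    norm_num
                _ ≤ s ^ 2 := by gcongr
            have h4 : s ^ 6 ≤ s ^ 9 := pow_le_pow_right₀ hs1 (by norm_num)
            calc 6 * s ^ 4 * (1024 * Q) ^ 2 = 6 * (1024 * Q) ^ 2 * s ^ 4 := by ring
              _ ≤ s ^ 2 * s ^ 4 := by gcongr
              _ = s ^ 6 := by ring
              _ ≤ N ^ 2 * P ^ 3 := h4.trans h₂
        _ = P * (Y * Y) := by rw [hY]; field_simp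
        _ ≤ P * (R * Y) := by gcongr
    exact le_of_mul_le_mul_left h1 hP
  have t₅ : 2 * (R * Y) ≤ R * d / 4 := by
    have h1 : 2 * (R * Y) = R * (N * P / (128 * Q)) / 4 := by rw [hY]; ring
    rw [h1]
    gcongr
  linarith

/-- The choice of the parameters: `c` bounds the sizes of the label classes from below, `D` bounds
the Breaker degrees, `d` bounds the degrees into the label classes, and `M` is the size of the sets
of roots that suffices to see most of the graph. -/
lemma exists_parameters {n q : ℕ} {P s L k : ℝ} (hq : 0 < q) (hP : 0 < P) (hP1 : P ≤ 1)
    (hL : 0 ≤ L) (hs : 2 ^ 24 * (q : ℝ) ≤ s) (hsL : 5 * (1 + L) ≤ s) (hk : k ≤ s)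
    (h₁ : s ^ 5 ≤ n * P) (h₂ : s ^ 9 ≤ (n : ℝ) ^ 2 * P ^ 3) :
    ∃ c D d M : ℕ, c + 1 ≤ n / q ∧ 4 * M ≤ c ∧ 1 ≤ M ∧ 1 ≤ D ∧ s / 2 ≤ D ∧ 16 * D ≤ d ∧
      16 * k ≤ d ∧ 32 ≤ d ∧ d + 3 * L ≤ P * c / 2 ∧ D + 3 * L ≤ P * M / 2 ∧
      (∀ a : ℕ, min M (d / 2) ≤ a → a ≤ M →
        4 * (D : ℝ) * a + (2 * a + 3) * L ≤ c * (P * a / (1 + P * a)) ^ 2 / 2) ∧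
      3 * P * M * (d / 16 : ℕ) + (3 * M + (d / 16 : ℕ) + 1) * L + 1 ≤
        (d / 16 : ℕ) * (d / 2 : ℕ) / 4 := by
  obtain ⟨Q, hQ⟩ : ∃ Q : ℝ, Q = q := ⟨_, rfl⟩
  obtain ⟨N, hN⟩ : ∃ N : ℝ, N = n := ⟨_, rfl⟩
  rw [← hQ] at hs
  rw [← hN] at h₁ h₂
  have hQ1 : 1 ≤ Q := by rw [hQ]; exact_mod_cast hq
  have hs24 : 2 ^ 24 ≤ s := by linarith
  have hs0 : 0 < s := by linarith
  have hs1 : 1 ≤ s := by linarith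
  have hs13 : s ≤ s ^ 3 := le_self_pow₀ hs1 (by norm_num)
  have hs34 : s ^ 3 ≤ s ^ 4 := pow_le_pow_right₀ hs1 (by norm_num)
  have hs45 : 2 ^ 24 * Q * s ^ 4 ≤ s ^ 5 := by
    calc 2 ^ 24 * Q * s ^ 4 ≤ s * s ^ 4 := by gcongr
      _ = s ^ 5 := by ring
  have hNs : s ^ 5 ≤ N := by
    have hN0 : 0 ≤ N := by rw [hN]; positivity
    calc s ^ 5 ≤ N * P := h₁
      _ ≤ N * 1 := by gcongr
      _ = N := mul_one N
  have hN0 : 0 < N := lt_of_lt_of_le (by positivity) hNs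
  obtain ⟨Z, hZ⟩ : ∃ Z : ℝ, Z = N * P / (16 * Q) := ⟨_, rfl⟩
  have hZs : 2 ^ 20 * s ^ 4 ≤ Z := by
    rw [hZ, le_div_iff₀ (by positivity)]
    linarith
  have hcge : N / (2 * Q) ≤ ((n / q - 1 : ℕ) : ℝ) := by
    have h1 : ((n / q : ℕ) : ℝ) ≤ ((n / q - 1 : ℕ) : ℝ) + 1 := by
      exact_mod_cast (by omega : n / q ≤ (n / q - 1) + 1)
    have h2 : N < Q * ((n / q : ℕ) + 1) := by
      rw [hN, hQ]
      exact_mod_cast Nat.lt_mul_div_succ n hq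
    have h3 : Q * ((n / q : ℕ) + 1) ≤ Q * (((n / q - 1 : ℕ) : ℝ) + 2) :=
      mul_le_mul_of_nonneg_left (by linarith) (by linarith)
    have h4 : 4 * Q ≤ N := by
      have h5 : 1 ≤ s ^ 4 := one_le_pow₀ hs1
      have h6 : 2 ^ 24 * Q * 1 ≤ 2 ^ 24 * Q * s ^ 4 := by gcongr
      linarith
    rw [div_le_iff₀ (by positivity)]
    linarith
  have hcpos : 1 ≤ n / q - 1 := by
    have h1 : (0 : ℝ) < ((n / q - 1 : ℕ) : ℝ) := lt_of_lt_of_le (by positivity) hcge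
    exact_mod_cast h1
  obtain ⟨c, hc⟩ : ∃ c : ℕ, c = n / q - 1 := ⟨_, rfl⟩
  rw [← hc] at hcge hcpos
  obtain ⟨D, hDle, hDge⟩ : ∃ D : ℕ, (D : ℝ) ≤ s ∧ s / 2 ≤ D := by
    refine ⟨⌊s⌋₊, Nat.floor_le hs0.le, ?_⟩
    have := Nat.lt_floor_add_one s
    linarith
  obtain ⟨d, hdle, hdge⟩ : ∃ d : ℕ, (d : ℝ) ≤ Z ∧ Z / 2 ≤ d := by
    have h3 : 0 ≤ s ^ 3 := by positivity
    refine ⟨⌊Z⌋₊, Nat.floor_le (by linarith), ?_⟩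
    have := Nat.lt_floor_add_one Z
    linarith
  obtain ⟨M, hM1, hMlow, hMup⟩ : ∃ M : ℕ, 1 ≤ M ∧ s ^ 3 ≤ P * M ∧ P * M ≤ 2 * s ^ 3 := by
    refine ⟨⌈s ^ 3 / P⌉₊, Nat.ceil_pos.2 (by positivity), ?_, ?_⟩
    · have := Nat.le_ceil (s ^ 3 / P)
      rw [div_le_iff₀ hP] at this
      linarith
    · have h1 := Nat.ceil_lt_add_one (show 0 ≤ s ^ 3 / P by positivity)
      have h2 : P * (⌈s ^ 3 / P⌉₊ : ℝ) ≤ P * (s ^ 3 / P + 1) := by gcongr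
      have h3 : P * (s ^ 3 / P + 1) = s ^ 3 + P := by field_simp
      linarith
  have hPc : 8 * Z ≤ P * c := by
    calc 8 * Z = P * (N / (2 * Q)) := by rw [hZ]; ring
      _ ≤ P * c := by gcongr
  have hMc : 4 * M ≤ c := by
    have h1 : P * (4 * M) ≤ P * c := by linarith
    have h2 : (4 * M : ℝ) ≤ c := le_of_mul_le_mul_left h1 hP
    exact_mod_cast h2
  have hdD : 16 * D ≤ d := by
    have : (16 * D : ℝ) ≤ d := by linarith
    exact_mod_cast this
  have hd32 : 32 ≤ d := by
    have : (32 : ℝ) ≤ d := by linarith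
    exact_mod_cast this
  have hd₂ge : N * P / (128 * Q) ≤ ((d / 2 : ℕ) : ℝ) := by
    have h1 : (d : ℝ) ≤ 4 * ((d / 2 : ℕ) : ℝ) := by exact_mod_cast (by omega : d ≤ 4 * (d / 2))
    have h2 : N * P / (128 * Q) = Z / 8 := by rw [hZ]; ring
    rw [h2]
    linarith
  have hRge : N * P / (1024 * Q) ≤ ((d / 16 : ℕ) : ℝ) := by
    have h1 : (d : ℝ) ≤ 32 * ((d / 16 : ℕ) : ℝ) := by exact_mod_cast (by omega : d ≤ 32 * (d / 16))
    have h2 : N * P / (1024 * Q) = Z / 64 := by rw [hZ]; ring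
    rw [h2]
    linarith
  have hR1 : (1 : ℝ) ≤ ((d / 16 : ℕ) : ℝ) := by exact_mod_cast (by omega : 1 ≤ d / 16)
  refine ⟨c, D, d, M, by omega, hMc, hM1, ?_, hDge, hdD, by linarith, hd32, by linarith, ?_, ?_, ?_⟩
  · have : (0 : ℝ) < D := by linarith
    exact_mod_cast this
  · have : s * 4 ≤ s ^ 3 := by
      calc s * 4 ≤ s * s ^ 2 := by
            gcongr
            have : s ≤ s ^ 2 := le_self_pow₀ hs1 (by norm_num)
            linarith
        _ = s ^ 3 := by ring
    linarith
  · intro a ha₀ haM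
    have ha1 : 1 ≤ a := le_trans (le_min hM1 (by omega)) ha₀
    refine common_condition hs hQ1 hN0 hP hL (by linarith) h₁ h₂ hDle hMlow hMup hcge hd₂ge
      (by exact_mod_cast ha1) ?_ (by exact_mod_cast haM)
    exact_mod_cast ha₀
  · exact concentrated_condition hs hQ1 hN0 hP hL hsL h₁ h₂ hMup hd₂ge hRge hR1

/-- The finite form of the theorem: `s` is a quantity that grows polynomially in `n`, with an
exponent so small that all the powers of `s` below are dominated. -/
lemma binomialRandom_not_connectorWins_le {n j : ℕ} {p : I} {s : ℝ} (hn : 0 < n)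
    (hs : 2 ^ 24 * (numLabels (j + 2) : ℝ) ≤ s) (hsL : 5 * (1 + Real.log n) ≤ s)
    (hK : 4 * ((j : ℝ) + 3) * (1 + Real.log n) ≤ s / 2)
    (h₁ : s ^ 5 ≤ n * p) (h₂ : s ^ 9 ≤ (n : ℝ) ^ 2 * (p : ℝ) ^ 3) (h₃ : (n : ℝ) ≤ (s / 2) ^ j)
    (first : Player) :
    SimpleGraph.binomialRandom (Fin n) p {G | ¬ ConnectorWins G 2 2 first} ≤
      4 * ENNReal.ofReal (Real.exp (-Real.log n)) := by
  have : Nonempty (Fin n) := ⟨⟨0, hn⟩⟩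
  have hL0 : 0 ≤ Real.log n := Real.log_natCast_nonneg n
  obtain ⟨q, hq⟩ : ∃ q, q = numLabels (j + 2) := ⟨_, rfl⟩
  have hq0 : 0 < q := hq ▸ numLabels_pos _
  rw [← hq] at hs
  have hs0 : 0 < s := by linarith
  have hP0 : (0 : ℝ) < p := by
    refine lt_of_le_of_ne p.2.1 fun h => ?_
    rw [← h, mul_zero] at h₁
    exact absurd (pow_pos hs0 5) (not_lt.2 h₁)
  have hKs : 4 * ((j : ℝ) + 3) ≤ s := by
    have : 4 * ((j : ℝ) + 3) * 1 ≤ 4 * ((j : ℝ) + 3) * (1 + Real.log n) := by gcongr; linarith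
    linarith
  obtain ⟨c, D, d, M, hcn, hMc, hM1, hD1, hDs, hDd, hKd, hd32, c₁, c₃, c₂, c₄⟩ :=
    exists_parameters (n := n) hq0 hP0 p.2.2 hL0 hs hsL hKs h₁ h₂
  have hKd' : 16 * (4 * (j + 3)) ≤ d := by exact_mod_cast hKd
  have hn_div := Nat.div_le_self n q
  have hqn : q ≤ n := by
    by_contra h
    rw [Nat.div_eq_of_lt (not_le.1 h)] at hcn
    omega
  have ha₀ : 1 ≤ min M (d / 2) := le_min hM1 (by omega)
  have hbound := binomialRandom_not_pseudorandom_le (V := Fin n) (p := p)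
    (cls := fun x => (x : ℕ) % q) (q := q) (d := d) (d₂ := d / 2) (a₀ := min M (d / 2)) (M := M)
    (R := d / 16) (D := D) (c := c) (by rwa [Fintype.card_fin]) hM1
    (by rw [Fintype.card_fin]; omega)
    (fun o ho => by
      have h1 := hcn.trans (le_card_filter_mod_eq (n := n) ho)
      convert h1) hMc
  rw [Fintype.card_fin] at hbound
  refine le_trans (MeasureTheory.measure_mono ?_) (hbound c₁ c₂ c₃ c₄)
  intro G hG hps
  refine hG ?_
  refine connectorWins_of_canEscape (J := j + 2) (K := 4 * (j + 3)) rfl ⟨0, hn⟩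
    (fun T B v hw hv hdeg hB => ?_) first
  refine Pseudorandom.canEscape (K := 4 * (j + 3)) hps hq.ge hD1 ha₀ (min_le_left _ _) ?_ ?_ ?_
    ?_ ?_ ?_ hw hv (fun u hu => ?_) hB
  · have : min M (d / 2) ≤ d / 2 := min_le_right _ _
    omega
  · have h1 : M ≤ n := by omega
    have h2 : (n : ℝ) ≤ (D : ℝ) ^ j := h₃.trans (pow_le_pow_left₀ (by positivity) hDs j)
    have h3 : n ≤ D ^ j := by exact_mod_cast h2
    exact (h1.trans h3).trans (Nat.le_mul_of_pos_left _ ha₀)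
  · omega
  · omega
  · omega
  · omega
  · have h1 := hdeg u hu
    rw [Fintype.card_fin] at h1
    push_cast at h1
    have h2 : (edgeDegree B u : ℝ) ≤ D := h1.trans (hK.trans hDs)
    exact_mod_cast h2

end Parameters

/-! ### Asymptotics -/

section Asymptotics

open Filter Topology

lemma tendsto_four_mul_exp_neg_log : Tendsto
    (fun n : ℕ => 4 * ENNReal.ofReal (Real.exp (-Real.log n))) atTop (𝓝 0) := by
  have h1 : Tendsto (fun n : ℕ => ENNReal.ofReal (Real.exp (-Real.log n))) atTop (𝓝 0) := by
    rw [← ENNReal.ofReal_zero]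
    refine ENNReal.tendsto_ofReal (Real.tendsto_exp_neg_atTop_nhds_zero.comp
      (Real.tendsto_log_atTop.comp tendsto_natCast_atTop_atTop))
  simpa using ENNReal.Tendsto.const_mul h1 (Or.inr (by norm_num))

lemma eventually_mul_one_add_log_le (C : ℝ) {η : ℝ} (hη : 0 < η) :
    ∀ᶠ n : ℕ in atTop, C * (1 + Real.log n) ≤ (n : ℝ) ^ η := by
  have h1 : (fun x : ℝ => C * (1 + Real.log x)) =o[atTop] fun x => x ^ η := by
    refine Asymptotics.IsLittleO.const_mul_left (Asymptotics.IsLittleO.add ?_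
      (isLittleO_log_rpow_atTop hη)) C
    rw [Asymptotics.isLittleO_const_left]
    exact Or.inr (tendsto_norm_atTop_atTop.comp (tendsto_rpow_atTop hη))
  have h2 := (h1.bound one_pos).filter_mono tendsto_natCast_atTop_atTop
  rw [eventually_map] at h2
  filter_upwards [h2] with n hn
  have h3 : 0 ≤ (n : ℝ) ^ η := by positivity
  rw [Real.norm_of_nonneg h3, one_mul] at hn
  exact (Real.le_norm_self _).trans hn

end Asymptotics

end ConnectorBreaker

theorem theorem1p5 (ε : ℝ) (hε : 0 < ε) (p : ℕ → unitInterval)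
    (hp : ∀ᶠ n : ℕ in Filter.atTop, (n : ℝ) ^ (-(2 / 3 : ℝ) + ε) ≤ (p n : ℝ))
    (first : ConnectorBreaker.Player) :
    Filter.Tendsto
      (fun n : ℕ => SimpleGraph.binomialRandom (Fin n) (p n)
        {G : SimpleGraph (Fin n) | ConnectorBreaker.ConnectorWins G 2 2 first})
      Filter.atTop (nhds 1) := by
  obtain ⟨η, hη, hη₁, hηε⟩ : ∃ η : ℝ, 0 < η ∧ η ≤ 1 / 24 ∧ η ≤ ε / 24 :=
    ⟨min 1 ε / 24, by positivity, by gcongr; exact min_le_left _ _,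
      by gcongr; exact min_le_right _ _⟩
  obtain ⟨j, hj⟩ := exists_nat_ge (2 / η)
  have hbad : ∀ᶠ n : ℕ in Filter.atTop, SimpleGraph.binomialRandom (Fin n) (p n)
      {G | ¬ ConnectorBreaker.ConnectorWins G 2 2 first} ≤
        4 * ENNReal.ofReal (Real.exp (-Real.log n)) := by
    filter_upwards [hp, Filter.eventually_gt_atTop 0,
      ConnectorBreaker.eventually_mul_one_add_log_le
        (2 ^ 24 * (ConnectorBreaker.numLabels (j + 2) : ℝ)) hη,
      ConnectorBreaker.eventually_mul_one_add_log_le 5 hη,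
      ConnectorBreaker.eventually_mul_one_add_log_le (2 * (4 * ((j : ℝ) + 3))) hη]
      with n hpn hn hq hL hK
    have hn0 : (0 : ℝ) ≤ n := n.cast_nonneg
    have hn0' : (0 : ℝ) < n := by exact_mod_cast hn
    have hn1 : (1 : ℝ) ≤ n := by exact_mod_cast hn
    have hL0 : 0 ≤ Real.log n := Real.log_natCast_nonneg n
    have hpow : ∀ k : ℕ, ((n : ℝ) ^ η) ^ k = (n : ℝ) ^ (η * k) := fun k => by
      rw [Real.rpow_mul hn0, Real.rpow_natCast]
    refine ConnectorBreaker.binomialRandom_not_connectorWins_le (s := (n : ℝ) ^ η) (j := j) hn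
      (le_trans (le_mul_of_one_le_right (by positivity) (by linarith)) hq) hL (by linarith)
      ?_ ?_ ?_ first
    · calc ((n : ℝ) ^ η) ^ 5 = (n : ℝ) ^ (η * (5 : ℕ)) := hpow 5
        _ ≤ (n : ℝ) ^ (1 + (-(2 / 3 : ℝ) + ε)) := by
            refine Real.rpow_le_rpow_of_exponent_le hn1 ?_
            push_cast
            linarith
        _ = n * (n : ℝ) ^ (-(2 / 3 : ℝ) + ε) := by rw [Real.rpow_add hn0', Real.rpow_one]
        _ ≤ n * p n := by gcongr
    · calc ((n : ℝ) ^ η) ^ 9 = (n : ℝ) ^ (η * (9 : ℕ)) := hpow 9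
        _ ≤ (n : ℝ) ^ (2 + (-(2 / 3 : ℝ) + ε) * 3) := by
            refine Real.rpow_le_rpow_of_exponent_le hn1 ?_
            push_cast
            linarith
        _ = (n : ℝ) ^ 2 * ((n : ℝ) ^ (-(2 / 3 : ℝ) + ε)) ^ 3 := by
            rw [Real.rpow_add hn0', Real.rpow_mul hn0]
            norm_cast
        _ ≤ (n : ℝ) ^ 2 * (p n : ℝ) ^ 3 := by gcongr
    · -- `s / 2 ≥ √s`, and `(√s) ^ j ≥ n` by the choice of `j`.
      have hs4 : 4 ≤ (n : ℝ) ^ η := by linarith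
      have hsqrt : (n : ℝ) ^ (η / 2) ≤ (n : ℝ) ^ η / 2 := by
        have h1 : (n : ℝ) ^ η = (n : ℝ) ^ (η / 2) * (n : ℝ) ^ (η / 2) := by
          rw [← Real.rpow_add hn0']
          ring_nf
        have h2 : 0 < (n : ℝ) ^ (η / 2) := by positivity
        nlinarith
      calc (n : ℝ) = (n : ℝ) ^ (1 : ℝ) := (Real.rpow_one _).symm
        _ ≤ (n : ℝ) ^ (η / 2 * j) := by
            refine Real.rpow_le_rpow_of_exponent_le hn1 ?_
            rw [div_le_iff₀ hη] at hj
            linarith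
        _ = ((n : ℝ) ^ (η / 2)) ^ j := by rw [Real.rpow_mul hn0, Real.rpow_natCast]
        _ ≤ ((n : ℝ) ^ η / 2) ^ j := by gcongr
  have hlim : Filter.Tendsto (fun n : ℕ => 1 - 4 * ENNReal.ofReal (Real.exp (-Real.log n)))
      Filter.atTop (nhds 1) := by
    have := ENNReal.Tendsto.sub (tendsto_const_nhds (x := (1 : ENNReal)) (f := Filter.atTop))
      ConnectorBreaker.tendsto_four_mul_exp_neg_log (Or.inl ENNReal.one_ne_top)
    rwa [tsub_zero] at this
  refine tendsto_of_tendsto_of_tendsto_of_le_of_le' hlim tendsto_const_nhds ?_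
    (Filter.Eventually.of_forall fun n => MeasureTheory.prob_le_one)
  filter_upwards [hbad] with n hn
  rw [tsub_le_iff_right]
  calc (1 : ENNReal) = SimpleGraph.binomialRandom (Fin n) (p n) Set.univ :=
        MeasureTheory.measure_univ.symm
    _ ≤ SimpleGraph.binomialRandom (Fin n) (p n)
          ({G | ConnectorBreaker.ConnectorWins G 2 2 first} ∪
            {G | ¬ ConnectorBreaker.ConnectorWins G 2 2 first}) :=
        MeasureTheory.measure_mono fun G _ => Classical.em _
    _ ≤ _ := (MeasureTheory.measure_union_le _ _).trans (by gcongr)
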